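/- Let $M$ be a smooth manifold (finite-dimensional, Hausdorff, second countable), and let $A_{-1},A_0$ be smooth vector bundles of finite rank over $M$. **Lie 2-algebroids.** A Lie 2-algebroid $(A_{-1}\oplus A_0;\rho,l_1,l_2,l_3)$ consists of bundle maps $\rho:A_0\to TM$, $l_1:A_{-1}\to A_0$, $l_3:\wedge^3A_0\to A_{-1}$ and skew-symmetric $\mathbb R$-bilinear brackets $l_2:\Gamma(A_0)\times\Gamma(A_0)\to\Gamma(A_0)$ and $l_2:\Gamma(A_0)\times\Gamma(A_{-1})\to\Gamma(A_{-1})$, $l_2(m,a)=-l_2(a,m)$, such that for $a,b,c,d\in\Gamma(A_0)$, $m,n\in\Gamma(A_{-1})$, $f\in C^\infty(M)$: * $l_2(a,fb)=f\,l_2(a,b)+\rho(a)(f)\,b$, $\;l_2(a,fm)=f\,l_2(a,m)+\rho(a)(f)\,m$, $\;l_2(fa,m)=f\,l_2(a,m)$; * $l_1l_2(a,m)=l_2(a,l_1m)$, $\;l_2(l_1m,n)=l_2(m,l_1n)$; * $l_1l_3(a,b,c)=l_2(a,l_2(b,c))-l_2(l_2(a,b),c)-l_2(b,l_2(a,c))$;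 * $l_3(a,b,l_1m)=l_2(a,l_2(b,m))-l_2(l_2(a,b),m)-l_2(b,l_2(a,m))$; * $l_2(a,l_3(b,c,d))-l_2(b,l_3(a,c,d))+l_2(c,l_3(a,b,d))-l_2(d,l_3(a,b,c))-l_3(l_2(a,b),c,d)-l_3(b,l_2(a,c),d)-l_3(b,c,l_2(a,d))+l_3(a,l_2(b,c),d)+l_3(a,c,l_2(b,d))-l_3(a,b,l_2(c,d))=0$. It follows that $\rho\circ l_1=0$ and $\rho(l_2(a,b))=[\rho(a),\rho(b)]$. The Lie 2-algebroid is transitive if $\rho$ is surjective on every fibre; then $\mathcal G=\ker\rho$ is a vector bundle. It is quadratic if it is transitive and equipped with a nondegenerate graded symmetric bilinear form $\mathcal S$ of degree $1$ on $A_{-1}\oplus\mathcal G$ (that is, a nondegenerate pairing of $\mathcal G$ with $A_{-1}$) such that $$\mathcal S(l_1m,p)=\mathcal S(m,l_1p),\qquad \rho(a)\,\mathcal S(u,m)=\mathcal S(l_2(a,u),m)+\mathcal S(u,l_2(a,m)),\qquad \mathcal S(l_3(a,b,u),v)=-\mathcal S(l_3(a,b,v),u)$$ for $u,v\in\Gamma(\mathcal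 G)$, $a,b\in\Gamma(A_0)$, $m,p\in\Gamma(A_{-1})$. **Splittings and curvatures.** A splitting $(\sigma,\gamma)$ consists of bundle maps $\sigma:TM\to A_0$ with $\rho\circ\sigma=\mathrm{id}$ and $\gamma:\wedge^2TM\to A_{-1}$. Put $\nabla^1_Xm=l_2(\sigma(X),m)$, let $d_{\nabla^1}$ be the corresponding covariant exterior derivative on $A_{-1}$-valued forms, and define the $\mathcal G$-valued $2$-forms $R,R_\gamma$ and the $A_{-1}$-valued $3$-forms $I,I_\gamma$ by $$R(X,Y)=\sigma[X,Y]-l_2(\sigma(X),\sigma(Y))-l_1\gamma(X,Y),\qquad I(X,Y,Z)=-d_{\nabla^1}\gamma(X,Y,Z)-l_3(\sigma(X),\sigma(Y),\sigma(Z)),$$ $$R_\gamma=R+l_1\circ\gamma,\qquad I_\gamma=I+d_{\nabla^1}\gamma .$$ For a $\mathcal G$-valued $2$-form $\Xi$ and an $A_{-1}$-valued $3$-form $\Pi$ let $\mathcal S(\Xi,\Pi)\in\Omega^5(M)$ be $$\mathcal S(\Xi,\Pi)(X_1,\dots,X_5)=\frac1{12}\sum_{\tau\in S_5}\mathrm{sgn}(\tau)\,\mathcal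 S\big(\Xi(X_{\tau(1)},X_{\tau(2)}),\Pi(X_{\tau(3)},X_{\tau(4)},X_{\tau(5)})\big).$$ **Theorem.** Let $(A_{-1}\oplus A_0;\rho,l_1,l_2,l_3)$ be a quadratic Lie 2-algebroid over $M$ with form $\mathcal S$. For every splitting $(\sigma,\gamma)$ the $5$-form $\mathcal S(R_\gamma,I_\gamma)$ is closed, and its de Rham class $[\mathcal S(R_\gamma,I_\gamma)]\in H^5(M)$ is the same for all splittings, i.e. it depends neither on $\sigma$ nor on $\gamma$. (This class is called the first Pontryagin class of the quadratic Lie 2-algebroid.) Moreover, for every splitting $(\sigma,\gamma)$ the $5$-form $\mathcal S(R,I)$ is closed as well and represents the same class. -/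

import Mathlib

open Bundle
open scoped Manifold ContDiff

section Geometry

variable {E : Type*} [NormedAddCommGroup E] [NormedSpace ℝ E]
  {M : Type*} [TopologicalSpace M] [ChartedSpace E M]

/-- Smooth real functions on `M`. -/
abbrev SmoothFun (E : Type*) [NormedAddCommGroup E] [NormedSpace ℝ E]
    (M : Type*) [TopologicalSpace M] [ChartedSpace E M] : Type _ :=
  C^∞⟮𝓘(ℝ, E), M; ℝ⟯

/-- Smooth sections `Γ(A)` of a vector bundle `A` with typical fibre `F`. -/
abbrev SmoothSec (E : Type*) [NormedAddCommGroup E] [NormedSpace ℝ E]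
    {M : Type*} [TopologicalSpace M] [ChartedSpace E M]
    (F : Type*) [NormedAddCommGroup F] [NormedSpace ℝ F]
    (A : M → Type*) [TopologicalSpace (TotalSpace F A)] [∀ x, TopologicalSpace (A x)]
    [FiberBundle F A] : Type _ :=
  Cₛ^∞⟮𝓘(ℝ, E); F, A⟯

/-- Smooth vector fields `𝔛(M) = Γ(TM)`. -/
abbrev SmoothVF (E : Type*) [NormedAddCommGroup E] [NormedSpace ℝ E]
    (M : Type*) [TopologicalSpace M] [ChartedSpace E M] [IsManifold 𝓘(ℝ, E) ∞ M] : Type _ :=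
  SmoothSec E E (fun x : M => TangentSpace 𝓘(ℝ, E) x)

section Module

variable {F : Type*} [NormedAddCommGroup F] [NormedSpace ℝ F]
  {A : M → Type*} [TopologicalSpace (TotalSpace F A)] [∀ x, TopologicalSpace (A x)]
  [FiberBundle F A] [∀ x, AddCommGroup (A x)] [∀ x, Module ℝ (A x)] [VectorBundle ℝ F A]

/-- Pointwise multiplication of a section by a function. -/
noncomputable instance SmoothSec.instSMulFun : SMul (SmoothFun E M) (SmoothSec E F A) :=
  ⟨fun f s => ⟨fun x => f x • s x, f.contMDiff.smul_section s.contMDiff⟩⟩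

@[simp] theorem SmoothSec.fun_smul_apply (f : SmoothFun E M) (s : SmoothSec E F A) (x : M) :
    (f • s) x = f x • s x := rfl

noncomputable instance SmoothSec.instModuleFun : Module (SmoothFun E M) (SmoothSec E F A) where
  one_smul s := by ext x; exact one_smul _ _
  mul_smul f g s := by ext x; exact mul_smul _ _ _
  smul_zero f := by ext x; exact smul_zero _
  smul_add f s t := by ext x; exact smul_add _ _ _
  add_smul f g s := by ext x; exact add_smul _ _ _
  zero_smul s := by ext x; exact zero_smul _ _

noncomputable instance SmoothSec.instIsScalarTower : IsScalarTower ℝ (SmoothFun E M) (SmoothSec E F A) where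
  smul_assoc c f s := by ext x; exact smul_assoc c (f x) (s x)

theorem SmoothSec.exists_eq [FiniteDimensional ℝ E] [T2Space M] [SigmaCompactSpace M]
    [IsManifold 𝓘(ℝ, E) ∞ M] [ContMDiffVectorBundle ∞ F A 𝓘(ℝ, E)] (x : M) (v : A x) :
    ∃ s : SmoothSec E F A, s x = v := by
  classical
  obtain ⟨s, hs⟩ := exists_contMDiffSection_forall_mem_convex_of_local (I := 𝓘(ℝ, E)) (n := ⊤)
    (F_fiber := F) A (fun y => {w | ∀ h : y = x, w = h ▸ v})
    (by
      intro y
      by_cases h : y = x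
      · subst h
        have : {w : A y | ∀ h : y = y, w = h ▸ v} = {v} := by ext w; simp
        rw [this]; exact convex_singleton _
      · have : {w : A y | ∀ h : y = x, w = h ▸ v} = Set.univ := by ext w; simp [h]
        rw [this]; exact convex_univ)
    (by
      intro y
      by_cases h : y = x
      · subst h
        obtain ⟨U, hU, hs⟩ := FiberBundle.exists_contMDiffOn_extend (k := ∞) 𝓘(ℝ, E) F v
        refine ⟨U, hU, _, hs, ?_⟩
        rintro z hz rfl
        simp
      · refine ⟨{x}ᶜ, isOpen_compl_singleton.mem_nhds h, fun _ => 0,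
          ((0 : SmoothSec E F A).contMDiff).contMDiffOn, ?_⟩
        intro z hz hzx
        exact absurd hzx hz)
  exact ⟨s, hs x rfl⟩

end Module

theorem SmoothSec.mdiffAt {F : Type*} [NormedAddCommGroup F] [NormedSpace ℝ F]
    {A : M → Type*} [TopologicalSpace (TotalSpace F A)] [∀ x, TopologicalSpace (A x)]
    [FiberBundle F A] (X : SmoothSec E F A) (x : M) :
    MDifferentiableAt 𝓘(ℝ, E) (𝓘(ℝ, E).prod 𝓘(ℝ, F)) (fun y => TotalSpace.mk' F y (X y)) x :=
  (X.contMDiff x).mdifferentiableAt (by simp)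

section VectorFields

variable [IsManifold 𝓘(ℝ, E) ∞ M]

/-- The derivative `X(f)` of a function along a vector field. -/
noncomputable def vfDeriv (X : SmoothVF E M) (f : SmoothFun E M) : SmoothFun E M :=
  ⟨fun x => mvfderiv 𝓘(ℝ, E) f x (X x), by
    have h1 : ContMDiff 𝓘(ℝ, E).tangent 𝓘(ℝ, ℝ).tangent ∞ (tangentMap 𝓘(ℝ, E) 𝓘(ℝ, ℝ) f) :=
      f.contMDiff.contMDiff_tangentMap (by simp)
    exact (contMDiff_snd_tangentBundle_modelSpace ℝ 𝓘(ℝ, ℝ)).comp (h1.comp X.contMDiff)⟩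

theorem vfDeriv_apply (X : SmoothVF E M) (f : SmoothFun E M) (x : M) :
    vfDeriv X f x = mvfderiv 𝓘(ℝ, E) f x (X x) := rfl

/-- The Lie bracket `[X, Y]` of vector fields. -/
noncomputable def vfBracket [FiniteDimensional ℝ E] (X Y : SmoothVF E M) : SmoothVF E M :=
  ⟨VectorField.mlieBracket 𝓘(ℝ, E) X Y, by
    have : CompleteSpace E := FiniteDimensional.complete ℝ E
    have : IsManifold 𝓘(ℝ, E) (((⊤ : ℕ∞) : WithTop ℕ∞) + 1) M := by simpa
    have : IsManifold 𝓘(ℝ, E) (minSmoothness ℝ 2) M := .of_le (n := ∞) (by simpa using WithTop.coe_le_coe.2 (le_top : (2 : ℕ∞) ≤ ⊤))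
    exact ContDiff.mlieBracket_vectorField (m := ⊤) (n := ⊤) X.contMDiff Y.contMDiff (by simp)⟩

theorem vfDeriv_add_left (X Y : SmoothVF E M) (f : SmoothFun E M) :
    vfDeriv (X + Y) f = vfDeriv X f + vfDeriv Y f := by
  ext x
  exact map_add (mvfderiv 𝓘(ℝ, E) f x) (X x) (Y x)

theorem vfDeriv_smul_left (g : SmoothFun E M) (X : SmoothVF E M) (f : SmoothFun E M) :
    vfDeriv (g • X) f = g * vfDeriv X f := by
  ext x
  exact map_smul (mvfderiv 𝓘(ℝ, E) f x) (g x) (X x)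

theorem vfDeriv_add (X : SmoothVF E M) (f g : SmoothFun E M) :
    vfDeriv X (f + g) = vfDeriv X f + vfDeriv X g := by
  ext x
  have := mvfderiv_add (f.mdifferentiableAt (x := x)) (g.mdifferentiableAt (x := x))
  exact congrArg (fun T => T (X x)) this

theorem vfDeriv_mul (X : SmoothVF E M) (f g : SmoothFun E M) :
    vfDeriv X (f * g) = f * vfDeriv X g + g * vfDeriv X f := by
  ext x
  have := mvfderiv_mul (f.mdifferentiableAt (x := x)) (g.mdifferentiableAt (x := x))
  exact congrArg (fun T => T (X x)) this

theorem vfDeriv_const_smul (X : SmoothVF E M) (c : ℝ) (f : SmoothFun E M) :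
    vfDeriv X (c • f) = c • vfDeriv X f := by
  have h : c • f = (algebraMap ℝ (SmoothFun E M) c) * f := Algebra.smul_def c f
  have h0 : vfDeriv X (algebraMap ℝ (SmoothFun E M) c) = 0 := by
    ext x
    exact congrArg (fun T => T (X x)) (mvfderiv_const (I := 𝓘(ℝ, E)) (x := x) c)
  rw [h, vfDeriv_mul, h0, mul_zero, add_zero, Algebra.smul_def]

/-- A vector field is determined by its action on functions. -/
theorem vf_eq_zero_of_deriv [FiniteDimensional ℝ E] [T2Space M] (X : SmoothVF E M)
    (h : ∀ f : SmoothFun E M, vfDeriv X f = 0) : X = 0 := by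
  ext x
  have : IsManifold 𝓘(ℝ, E) 1 M := .of_le (n := ∞) (by exact mod_cast le_top)
  have hx : x ∈ (extChartAt 𝓘(ℝ, E) x).source := mem_extChartAt_source x
  have hd : MDifferentiableAt 𝓘(ℝ, E) 𝓘(ℝ, E) (extChartAt 𝓘(ℝ, E) x) x :=
    mdifferentiableAt_extChartAt (mem_chart_source E x)
  obtain ⟨b⟩ : Nonempty (SmoothBumpFunction 𝓘(ℝ, E) x) := inferInstance
  let φ : M → E := fun y => b y • extChartAt 𝓘(ℝ, E) x y
  have hφ : ContMDiff 𝓘(ℝ, E) 𝓘(ℝ, E) ∞ φ := b.contMDiff_smul contMDiffOn_extChartAt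
  have hφx : mfderiv 𝓘(ℝ, E) 𝓘(ℝ, E) φ x = mfderiv 𝓘(ℝ, E) 𝓘(ℝ, E) (extChartAt 𝓘(ℝ, E) x) x := by
    apply Filter.EventuallyEq.mfderiv_eq
    filter_upwards [b.eventuallyEq_one] with y hy
    simp [φ, hy]
  have key : mfderiv 𝓘(ℝ, E) 𝓘(ℝ, E) φ x (X x) = 0 := by
    have hl : ∀ l : E →L[ℝ] ℝ, l (mfderiv 𝓘(ℝ, E) 𝓘(ℝ, E) φ x (X x)) = 0 := by
      intro l
      have h1 := congrArg (fun g : SmoothFun E M => g x)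
        (h ⟨fun y => l (φ y), l.contMDiff.comp hφ⟩)
      have h2 := mvfderiv_comp_apply (g := l) (f := φ) x
        (l.mdifferentiableAt) ((hφ x).mdifferentiableAt (by simp)) (X x)
      have h3 : mvfderiv 𝓘(ℝ, E) (l ∘ φ) x (X x) = 0 := h1
      rw [h3] at h2
      have h4 : mvfderiv 𝓘(ℝ, E) l (φ x) = l := by
        unfold mvfderiv; rw [l.mfderiv_eq]; rfl
      rw [h2]
      exact congrArg (fun T => T (mfderiv 𝓘(ℝ, E) 𝓘(ℝ, E) φ x (X x))) h4.symm
    exact SeparatingDual.eq_zero_of_forall_dual_eq_zero (R := ℝ) (V := E) hl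
  rw [hφx] at key
  exact (isInvertible_mfderiv_extChartAt hx).injective (key.trans (map_zero _).symm)

section Bracket
variable [FiniteDimensional ℝ E]

theorem vfBracket_self (X : SmoothVF E M) : vfBracket X X = 0 := by
  ext x
  exact congrFun (VectorField.mlieBracket_self (I := 𝓘(ℝ, E)) (V := X)) x

theorem vfBracket_swap (X Y : SmoothVF E M) : vfBracket X Y = - vfBracket Y X := by
  ext x
  exact congrFun (VectorField.mlieBracket_swap (I := 𝓘(ℝ, E)) (V := X) (W := Y)) x

theorem vfBracket_add_right (X Y Z : SmoothVF E M) :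
    vfBracket X (Y + Z) = vfBracket X Y + vfBracket X Z := by
  have : CompleteSpace E := FiniteDimensional.complete ℝ E
  have : IsManifold 𝓘(ℝ, E) 1 M := .of_le (n := ∞) (by exact mod_cast le_top)
  ext x
  exact VectorField.mlieBracket_add_right (SmoothSec.mdiffAt Y x) (SmoothSec.mdiffAt Z x)

theorem vfBracket_add_left (X Y Z : SmoothVF E M) :
    vfBracket (X + Y) Z = vfBracket X Z + vfBracket Y Z := by
  rw [vfBracket_swap, vfBracket_add_right, vfBracket_swap Z X, vfBracket_swap Z Y]; abel

theorem vfBracket_smul_right (X Y : SmoothVF E M) (f : SmoothFun E M) :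
    vfBracket X (f • Y) = f • vfBracket X Y + vfDeriv X f • Y := by
  have : CompleteSpace E := FiniteDimensional.complete ℝ E
  have : IsManifold 𝓘(ℝ, E) 1 M := .of_le (n := ∞) (by exact mod_cast le_top)
  ext x
  refine (VectorField.mlieBracket_smul_right (V := X) (f.mdifferentiableAt (x := x))
    (SmoothSec.mdiffAt Y x)).trans ?_
  exact add_comm _ _

theorem vfBracket_smul_left (X Y : SmoothVF E M) (f : SmoothFun E M) :
    vfBracket (f • X) Y = f • vfBracket X Y - vfDeriv Y f • X := by
  rw [vfBracket_swap, vfBracket_smul_right, vfBracket_swap Y X, smul_neg]; abel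

theorem vfBracket_jacobi (X Y Z : SmoothVF E M) :
    vfBracket X (vfBracket Y Z) = vfBracket (vfBracket X Y) Z + vfBracket Y (vfBracket X Z) := by
  have : CompleteSpace E := FiniteDimensional.complete ℝ E
  have : IsManifold 𝓘(ℝ, E) (minSmoothness ℝ 3) M :=
    .of_le (n := ∞) (by simpa using WithTop.coe_le_coe.2 (le_top : (3 : ℕ∞) ≤ ⊤))
  have h : minSmoothness ℝ 2 ≤ ∞ := by
    simpa using WithTop.coe_le_coe.2 (le_top : (2 : ℕ∞) ≤ ⊤)
  ext x
  exact VectorField.leibniz_identity_mlieBracket_apply ((X.contMDiff x).of_le h)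
    ((Y.contMDiff x).of_le h) ((Z.contMDiff x).of_le h)

theorem vfDeriv_bracket [T2Space M] [SigmaCompactSpace M] (X Y : SmoothVF E M)
    (f : SmoothFun E M) :
    vfDeriv (vfBracket X Y) f = vfDeriv X (vfDeriv Y f) - vfDeriv Y (vfDeriv X f) := by
  have key : ∀ Z : SmoothVF E M, (vfDeriv (vfBracket X Y) f -
      (vfDeriv X (vfDeriv Y f) - vfDeriv Y (vfDeriv X f))) • Z = 0 := by
    intro Z
    have h := vfBracket_jacobi X Y (f • Z)
    simp only [vfBracket_smul_right, vfBracket_add_right, vfBracket_jacobi X Y Z, smul_add] at h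
    rw [sub_smul, sub_smul]
    rw [← sub_eq_zero] at h
    rw [← neg_eq_zero, ← h]
    abel
  ext x
  by_cases hE : Subsingleton E
  · have h0 : ∀ Z : SmoothVF E M, Z = 0 := fun Z => by
      ext y; exact Subsingleton.elim (α := E) _ _
    have h1 : ∀ g : SmoothFun E M, vfDeriv 0 g = 0 := fun g => by
      ext y; exact map_zero (mvfderiv 𝓘(ℝ, E) g y)
    rw [h0 (vfBracket X Y), h0 X, h0 Y]; simp [h1]
  · obtain ⟨v, hv⟩ : ∃ v : E, v ≠ 0 := by
      rw [not_subsingleton_iff_nontrivial] at hE; exact exists_ne 0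
    obtain ⟨Z, hZ⟩ := SmoothSec.exists_eq (E := E) (F := E)
      (A := fun x : M => TangentSpace 𝓘(ℝ, E) x) x v
    have h2 := congrArg (fun s : SmoothVF E M => s x) (key Z)
    have h3 := (smul_eq_zero.mp h2).resolve_right (by rw [hZ]; exact hv)
    exact sub_eq_zero.mp h3

end Bracket
end VectorFields

section Forms

/-- The pairing of two vector-valued alternating forms with respect to a bilinear map `B`,
`(Ξ, Ψ) ↦ (1 / (k! l!)) ∑_τ sgn τ B(Ξ(X_τ(1), …, X_τ(k)), Ψ(X_τ(k+1), …, X_τ(k+l)))`. -/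
noncomputable def pairForm {R V N₁ N₂ N : Type*} [CommRing R] [Algebra ℝ R]
    [AddCommGroup V] [Module R V] [AddCommGroup N₁] [Module R N₁] [AddCommGroup N₂] [Module R N₂]
    [AddCommGroup N] [Module R N] [Module ℝ N] [SMulCommClass R ℝ N]
    (B : N₁ →ₗ[R] N₂ →ₗ[R] N) {k l : ℕ} (Ξ : V [⋀^Fin k]→ₗ[R] N₁) (Ψ : V [⋀^Fin l]→ₗ[R] N₂) :
    V [⋀^Fin (k + l)]→ₗ[R] N :=
  ((k.factorial * l.factorial : ℝ)⁻¹) • MultilinearMap.alternatization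
    ((TensorProduct.lift B).compMultilinearMap
      ((MultilinearMap.domCoprod (Ξ : MultilinearMap R (fun _ : Fin k => V) N₁)
        (Ψ : MultilinearMap R (fun _ : Fin l => V) N₂)).domDomCongr finSumFinEquiv))

theorem pairForm_apply {R V N₁ N₂ N : Type*} [CommRing R] [Algebra ℝ R]
    [AddCommGroup V] [Module R V] [AddCommGroup N₁] [Module R N₁] [AddCommGroup N₂] [Module R N₂]
    [AddCommGroup N] [Module R N] [Module ℝ N] [SMulCommClass R ℝ N]
    (B : N₁ →ₗ[R] N₂ →ₗ[R] N) {k l : ℕ} (Ξ : V [⋀^Fin k]→ₗ[R] N₁) (Ψ : V [⋀^Fin l]→ₗ[R] N₂)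
    (X : Fin (k + l) → V) :
    pairForm B Ξ Ψ X = ((k.factorial * l.factorial : ℝ)⁻¹) • ∑ τ : Equiv.Perm (Fin (k + l)),
      Equiv.Perm.sign τ • B (Ξ fun i => X (τ (Fin.castAdd l i)))
        (Ψ fun j => X (τ (Fin.natAdd k j))) := by
  simp [pairForm, MultilinearMap.alternatization_apply, AlternatingMap.smul_apply]

/-- A skew-symmetric bilinear operation, as an alternating form. -/
def altTwo {R V N : Type*} [CommRing R] [AddCommGroup V] [Module R V] [AddCommGroup N] [Module R N]
    (f : V → V → N) (hself : ∀ x, f x x = 0) (hswap : ∀ x y, f x y = - f y x)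
    (hadd : ∀ x y z, f (x + y) z = f x z + f y z) (hsmul : ∀ (r : R) x y, f (r • x) y = r • f x y) :
    V [⋀^Fin 2]→ₗ[R] N where
  toFun v := f (v 0) (v 1)
  map_update_add' := by
    intro inst v i x y
    cases Subsingleton.elim inst (instDecidableEqFin 2)
    have hadd' : ∀ x y z, f z (x + y) = f z x + f z y := fun x y z => by
      rw [hswap, hadd, hswap z x, hswap z y, neg_add]
    fin_cases i <;> simp [hadd, hadd']
  map_update_smul' := by
    intro inst v i r x
    cases Subsingleton.elim inst (instDecidableEqFin 2)
    have hsmul' : ∀ (r : R) x y, f x (r • y) = r • f x y := fun r x y => by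
      rw [hswap, hsmul, hswap x y, smul_neg]
    fin_cases i <;> simp [hsmul, hsmul']
  map_eq_zero_of_eq' v i j h hij := by
    fin_cases i <;> fin_cases j <;> simp at h hij ⊢ <;> simp [h, hself]

/-- A trilinear skew-symmetric operation, as an alternating form. -/
def altThree {R V N : Type*} [CommRing R] [AddCommGroup V] [Module R V] [AddCommGroup N]
    [Module R N] (f : V → V → V → N) (hself : ∀ x y, f x x y = 0)
    (hswap : ∀ x y z, f x y z = - f y x z) (hswap' : ∀ x y z, f x y z = - f x z y)
    (hadd : ∀ x y z w, f (x + y) z w = f x z w + f y z w)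
    (hsmul : ∀ (r : R) x y z, f (r • x) y z = r • f x y z) :
    V [⋀^Fin 3]→ₗ[R] N where
  toFun v := f (v 0) (v 1) (v 2)
  map_update_add' := by
    intro inst v i x y
    cases Subsingleton.elim inst (instDecidableEqFin 3)
    have hadd2 : ∀ x y z w, f z (x + y) w = f z x w + f z y w := fun x y z w => by
      rw [hswap, hadd, hswap z x, hswap z y, neg_add]
    have hadd3 : ∀ x y z w, f z w (x + y) = f z w x + f z w y := fun x y z w => by
      rw [hswap', hadd2, hswap' z w x, hswap' z w y, neg_add]
    fin_cases i <;> simp [hadd, hadd2, hadd3]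
  map_update_smul' := by
    intro inst v i r x
    cases Subsingleton.elim inst (instDecidableEqFin 3)
    have hsmul2 : ∀ (r : R) x y z, f x (r • y) z = r • f x y z := fun r x y z => by
      rw [hswap, hsmul, hswap x y, smul_neg]
    have hsmul3 : ∀ (r : R) x y z, f x y (r • z) = r • f x y z := fun r x y z => by
      rw [hswap', hsmul2, hswap' x y, smul_neg]
    fin_cases i <;> simp [hsmul, hsmul2, hsmul3]
  map_eq_zero_of_eq' v i j h hij := by
    have h2 : ∀ x y, f y x x = 0 := fun x y => by
      rw [hswap, hswap', hself, neg_zero, neg_zero]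
    have h3 : ∀ x y, f x y x = 0 := fun x y => by
      rw [hswap', hself, neg_zero]
    fin_cases i <;> fin_cases j <;> simp at h hij ⊢ <;> simp [h, hself, h2, h3]

theorem vfDeriv_zsmul [IsManifold 𝓘(ℝ, E) ∞ M] (X : SmoothVF E M) (c : ℤ) (f : SmoothFun E M) :
    vfDeriv X (c • f) = c • vfDeriv X f := by
  rw [← Int.cast_smul_eq_zsmul ℝ c f, vfDeriv_const_smul, Int.cast_smul_eq_zsmul]

variable [IsManifold 𝓘(ℝ, E) ∞ M] [FiniteDimensional ℝ E]

/-- Differential `k`-forms on `M`: alternating `C^∞(M)`-multilinear maps on vector fields. -/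
abbrev DiffForm (E : Type*) [NormedAddCommGroup E] [NormedSpace ℝ E]
    (M : Type*) [TopologicalSpace M] [ChartedSpace E M] [IsManifold 𝓘(ℝ, E) ∞ M] (k : ℕ) : Type _ :=
  SmoothVF E M [⋀^Fin k]→ₗ[SmoothFun E M] SmoothFun E M

/-- The exterior derivative of a `k`-form, evaluated on `k + 1` vector fields by the usual formula
`∑_i (-1)^i X_i(α(…, X̂_i, …)) + ∑_{i<j} (-1)^{i+j} α([X_i, X_j], …, X̂_i, …, X̂_j, …)`
(indices starting at `0`). In the second sum the bracket `[X_i, X_j]` is left in the slot of `X_i`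
instead of being moved to the front, which absorbs the sign `(-1)^i`. -/
noncomputable def extDer {k : ℕ} (α : DiffForm E M k) (X : Fin (k + 1) → SmoothVF E M) :
    SmoothFun E M :=
  (∑ i : Fin (k + 1), (-1 : ℤ) ^ (i : ℕ) • vfDeriv (X i) (α fun l => X (i.succAbove l))) +
    ∑ i : Fin (k + 1), ∑ j ∈ Finset.Ioi i,
      (-1 : ℤ) ^ (j : ℕ) • α fun l => Function.update X i (vfBracket (X i) (X j)) (j.succAbove l)

theorem extDer_add {k : ℕ} (α η : DiffForm E M k) (X : Fin (k + 1) → SmoothVF E M) :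
    extDer (α + η) X = extDer α X + extDer η X := by
  simp only [extDer, AlternatingMap.add_apply, vfDeriv_add, smul_add, Finset.sum_add_distrib]
  abel

theorem extDer_zero {k : ℕ} (X : Fin (k + 1) → SmoothVF E M) :
    extDer (0 : DiffForm E M k) X = 0 := by
  have h := extDer_add (0 : DiffForm E M k) 0 X
  rwa [add_zero, left_eq_add] at h

theorem extDer_neg {k : ℕ} (α : DiffForm E M k) (X : Fin (k + 1) → SmoothVF E M) :
    extDer (-α) X = -extDer α X := by
  have h := extDer_add (-α) α X
  rw [neg_add_cancel, extDer_zero] at h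
  exact eq_neg_of_add_eq_zero_left h.symm

/-- Closed `k`-forms. -/
noncomputable def closedForms (E : Type*) [NormedAddCommGroup E] [NormedSpace ℝ E]
    [FiniteDimensional ℝ E]
    (M : Type*) [TopologicalSpace M] [ChartedSpace E M] [IsManifold 𝓘(ℝ, E) ∞ M] (k : ℕ) :
    AddSubgroup (DiffForm E M k) where
  carrier := {α | ∀ X, extDer α X = 0}
  add_mem' h h' X := by rw [extDer_add, h X, h' X, add_zero]
  zero_mem' X := by rw [extDer_zero]
  neg_mem' h X := by rw [extDer_neg, h X, neg_zero]

/-- Exact `k`-forms: those of the form `dη` for a `(k - 1)`-form `η`, and only `0` if `k = 0`. -/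
noncomputable def exactForms (E : Type*) [NormedAddCommGroup E] [NormedSpace ℝ E]
    [FiniteDimensional ℝ E]
    (M : Type*) [TopologicalSpace M] [ChartedSpace E M] [IsManifold 𝓘(ℝ, E) ∞ M] :
    (k : ℕ) → AddSubgroup (DiffForm E M k)
  | 0 => ⊥
  | k + 1 =>
    { carrier := {α | ∃ η : DiffForm E M k, ∀ X, α X = extDer η X}
      add_mem' := by
        rintro α α' ⟨η, h⟩ ⟨η', h'⟩
        exact ⟨η + η', fun X => by rw [AlternatingMap.add_apply, h, h', extDer_add]⟩
      zero_mem' := ⟨0, fun X => by rw [extDer_zero, AlternatingMap.zero_apply]⟩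
      neg_mem' := by
        rintro α ⟨η, h⟩
        exact ⟨-η, fun X => by rw [AlternatingMap.neg_apply, h, extDer_neg]⟩ }

/-- De Rham cohomology `H^k(M)`: closed forms modulo exact forms. -/
abbrev DeRham (E : Type*) [NormedAddCommGroup E] [NormedSpace ℝ E] [FiniteDimensional ℝ E]
    (M : Type*) [TopologicalSpace M] [ChartedSpace E M] [IsManifold 𝓘(ℝ, E) ∞ M] (k : ℕ) : Type _ :=
  closedForms E M k ⧸ (exactForms E M k).comap (closedForms E M k).subtype

/-- The de Rham class of a closed form. -/
noncomputable def deRhamClass {k : ℕ} (α : DiffForm E M k) (h : α ∈ closedForms E M k) :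
    DeRham E M k :=
  QuotientAddGroup.mk ⟨α, h⟩

end Forms

section Algebroid

variable [IsManifold 𝓘(ℝ, E) ∞ M] [FiniteDimensional ℝ E]

/-- A (split) Lie 2-algebroid `(A₁ ⊕ A₀; ρ, l₁, l₂, l₃)` over `M`, with `A₀` in degree `0` and `A₁`
in degree `-1`. Bundle maps are given by the induced `C^∞(M)`-linear maps on sections. The bracket
`l₂` has a component `l2` on `Γ(A₀) × Γ(A₀)` and a component `act` on `Γ(A₀) × Γ(A₁)`; its component
on `Γ(A₁) × Γ(A₀)` is determined by skew-symmetry, `l₂(m, a) = -act a m`, and its component on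
`Γ(A₁) × Γ(A₁)` vanishes for degree reasons. -/
structure LieTwoAlgebroid (E : Type*) [NormedAddCommGroup E] [NormedSpace ℝ E]
    [FiniteDimensional ℝ E] {M : Type*} [TopologicalSpace M] [ChartedSpace E M]
    [IsManifold 𝓘(ℝ, E) ∞ M]
    (F₀ : Type*) [NormedAddCommGroup F₀] [NormedSpace ℝ F₀]
    (A₀ : M → Type*) [TopologicalSpace (TotalSpace F₀ A₀)] [∀ x, TopologicalSpace (A₀ x)]
    [FiberBundle F₀ A₀] [∀ x, AddCommGroup (A₀ x)] [∀ x, Module ℝ (A₀ x)] [VectorBundle ℝ F₀ A₀]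
    (F₁ : Type*) [NormedAddCommGroup F₁] [NormedSpace ℝ F₁]
    (A₁ : M → Type*) [TopologicalSpace (TotalSpace F₁ A₁)] [∀ x, TopologicalSpace (A₁ x)]
    [FiberBundle F₁ A₁] [∀ x, AddCommGroup (A₁ x)] [∀ x, Module ℝ (A₁ x)]
    [VectorBundle ℝ F₁ A₁] where
  /-- the anchor `ρ : A₀ → TM` -/
  ρ : SmoothSec E F₀ A₀ →ₗ[SmoothFun E M] SmoothVF E M
  /-- `l₁ : A₁ → A₀` -/
  l1 : SmoothSec E F₁ A₁ →ₗ[SmoothFun E M] SmoothSec E F₀ A₀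
  /-- `l₂` on `Γ(A₀) × Γ(A₀)` -/
  l2 : SmoothSec E F₀ A₀ →ₗ[ℝ] SmoothSec E F₀ A₀ →ₗ[ℝ] SmoothSec E F₀ A₀
  /-- `l₂` on `Γ(A₀) × Γ(A₁)` -/
  act : SmoothSec E F₀ A₀ →ₗ[ℝ] SmoothSec E F₁ A₁ →ₗ[ℝ] SmoothSec E F₁ A₁
  /-- `l₃ : ∧³ A₀ → A₁` -/
  l3 : SmoothSec E F₀ A₀ [⋀^Fin 3]→ₗ[SmoothFun E M] SmoothSec E F₁ A₁
  l2_self : ∀ a, l2 a a = 0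
  l2_leibniz : ∀ a (f : SmoothFun E M) b, l2 a (f • b) = f • l2 a b + vfDeriv (ρ a) f • b
  act_leibniz : ∀ a (f : SmoothFun E M) m, act a (f • m) = f • act a m + vfDeriv (ρ a) f • m
  /-- `l₂(m, f a) = f l₂(m, a)`: the anchor vanishes on `A₁` -/
  act_smul : ∀ (f : SmoothFun E M) a m, act (f • a) m = f • act a m
  l1_act : ∀ a m, l1 (act a m) = l2 a (l1 m)
  act_l1 : ∀ m n, act (l1 m) n = -act (l1 n) m
  l1_l3 : ∀ a b c, l1 (l3 ![a, b, c]) = l2 a (l2 b c) - l2 (l2 a b) c - l2 b (l2 a c)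
  l3_l1 : ∀ a b m, l3 ![a, b, l1 m] = act a (act b m) - act (l2 a b) m - act b (act a m)
  jacobiator : ∀ a b c d,
    act a (l3 ![b, c, d]) - act b (l3 ![a, c, d]) + act c (l3 ![a, b, d]) - act d (l3 ![a, b, c])
      - l3 ![l2 a b, c, d] - l3 ![b, l2 a c, d] - l3 ![b, c, l2 a d]
      + l3 ![a, l2 b c, d] + l3 ![a, c, l2 b d] - l3 ![a, b, l2 c d] = 0

namespace LieTwoAlgebroid

variable {F₀ : Type*} [NormedAddCommGroup F₀] [NormedSpace ℝ F₀]
  {A₀ : M → Type*} [TopologicalSpace (TotalSpace F₀ A₀)] [∀ x, TopologicalSpace (A₀ x)]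
  [FiberBundle F₀ A₀] [∀ x, AddCommGroup (A₀ x)] [∀ x, Module ℝ (A₀ x)] [VectorBundle ℝ F₀ A₀]
  {F₁ : Type*} [NormedAddCommGroup F₁] [NormedSpace ℝ F₁]
  {A₁ : M → Type*} [TopologicalSpace (TotalSpace F₁ A₁)] [∀ x, TopologicalSpace (A₁ x)]
  [FiberBundle F₁ A₁] [∀ x, AddCommGroup (A₁ x)] [∀ x, Module ℝ (A₁ x)] [VectorBundle ℝ F₁ A₁]
  (L : LieTwoAlgebroid E F₀ A₀ F₁ A₁)

/-- Sections of `𝒢 = ker ρ`. -/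
noncomputable abbrev ker : Submodule (SmoothFun E M) (SmoothSec E F₀ A₀) := LinearMap.ker L.ρ

theorem l2_swap (a b : SmoothSec E F₀ A₀) : L.l2 a b = -L.l2 b a := by
  have h := L.l2_self (a + b)
  simp only [map_add, LinearMap.add_apply, L.l2_self, zero_add, add_zero] at h
  exact eq_neg_of_add_eq_zero_right h

section Anchor
variable [T2Space M] [SigmaCompactSpace M]

theorem eq_zero_of_deriv_smul {F : Type*} [NormedAddCommGroup F] [NormedSpace ℝ F]
    {A : M → Type*} [TopologicalSpace (TotalSpace F A)] [∀ x, TopologicalSpace (A x)]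
    [FiberBundle F A] [∀ x, AddCommGroup (A x)] [∀ x, Module ℝ (A x)] [VectorBundle ℝ F A]
    [ContMDiffVectorBundle ∞ F A 𝓘(ℝ, E)] (X : SmoothVF E M)
    (h : ∀ (f : SmoothFun E M) (s : SmoothSec E F A), vfDeriv X f • s = 0)
    (h0 : (∀ s : SmoothSec E F A, s = 0) → X = 0) : X = 0 := by
  by_cases hF : Subsingleton F
  · apply h0
    intro s
    ext x
    have e := (trivializationAt F A x).linearEquivAt ℝ x
      (FiberBundle.mem_baseSet_trivializationAt F A x)
    exact e.injective (Subsingleton.elim _ _)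
  · rw [not_subsingleton_iff_nontrivial] at hF
    apply vf_eq_zero_of_deriv
    intro f
    ext x
    obtain ⟨w, hw⟩ := exists_ne (0 : F)
    have e := (trivializationAt F A x).linearEquivAt ℝ x
      (FiberBundle.mem_baseSet_trivializationAt F A x)
    obtain ⟨s, hs⟩ := SmoothSec.exists_eq (E := E) (F := F) (A := A) x (e.symm w)
    have h1 := congrArg (fun t : SmoothSec E F A => t x) (h f s)
    refine (smul_eq_zero.mp h1).resolve_right ?_
    rw [hs]
    simpa using hw

theorem ρ_l1 [ContMDiffVectorBundle ∞ F₁ A₁ 𝓘(ℝ, E)] (m : SmoothSec E F₁ A₁) :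
    L.ρ (L.l1 m) = 0 := by
  apply eq_zero_of_deriv_smul (F := F₁) (A := A₁)
  · intro f n
    have h1 := L.act_leibniz (L.l1 m) f n
    rw [L.act_l1, map_smul, L.act_smul, L.act_l1 n m, smul_neg, neg_neg, left_eq_add] at h1
    exact h1
  · intro h
    rw [h m, map_zero, map_zero]

theorem ρ_l2 [ContMDiffVectorBundle ∞ F₀ A₀ 𝓘(ℝ, E)] (a b : SmoothSec E F₀ A₀) :
    L.ρ (L.l2 a b) = vfBracket (L.ρ a) (L.ρ b) := by
  rw [← sub_eq_zero]
  apply eq_zero_of_deriv_smul (F := F₀) (A := A₀)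
  · intro f c
    have h1 := L.l1_l3 a b (f • c)
    have h2 : L.l3 ![a, b, f • c] = f • L.l3 ![a, b, c] := by
      have h2 := L.l3.map_update_smul ![a, b, c] 2 f c
      rwa [show Function.update ![a, b, c] 2 (f • c) = ![a, b, f • c] by
          ext i; fin_cases i <;> rfl,
        show Function.update ![a, b, c] 2 c = ![a, b, c] by ext i; fin_cases i <;> rfl] at h2
    rw [h2, map_smul, L.l1_l3] at h1
    simp only [L.l2_leibniz, map_add, smul_sub] at h1
    have h3 : vfDeriv (L.ρ (L.l2 a b) - vfBracket (L.ρ a) (L.ρ b)) f =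
        vfDeriv (L.ρ (L.l2 a b)) f - (vfDeriv (L.ρ a) (vfDeriv (L.ρ b) f)
          - vfDeriv (L.ρ b) (vfDeriv (L.ρ a) f)) := by
      rw [← vfDeriv_bracket]
      ext x
      exact map_sub (mvfderiv 𝓘(ℝ, E) f x) _ _
    rw [h3, sub_smul, sub_smul]
    rw [← sub_eq_zero] at h1
    rw [← h1]
    abel
  · intro h
    rw [h (L.l2 a b), h a, h b, map_zero, vfBracket_self, sub_zero]

end Anchor

/-- A splitting (connection) `(σ, γ)`: a section `σ : TM → A₀` of the anchor and a bundle map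
`γ : ∧² TM → A₁`. -/
structure Splitting where
  σ : SmoothVF E M →ₗ[SmoothFun E M] SmoothSec E F₀ A₀
  ρ_σ : ∀ X, L.ρ (σ X) = X
  γ : SmoothVF E M [⋀^Fin 2]→ₗ[SmoothFun E M] SmoothSec E F₁ A₁

namespace Splitting

variable {L} (s : L.Splitting)

/-- `∇¹_X m = l₂(σ(X), m)`. -/
noncomputable def nabla1 (X : SmoothVF E M) (m : SmoothSec E F₁ A₁) : SmoothSec E F₁ A₁ :=
  L.act (s.σ X) m

theorem nabla1_add (X : SmoothVF E M) (m n : SmoothSec E F₁ A₁) :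
    s.nabla1 X (m + n) = s.nabla1 X m + s.nabla1 X n := map_add _ _ _

theorem nabla1_neg (X : SmoothVF E M) (m : SmoothSec E F₁ A₁) :
    s.nabla1 X (-m) = -s.nabla1 X m := map_neg _ _

theorem nabla1_zero (X : SmoothVF E M) : s.nabla1 X 0 = 0 := map_zero _

theorem nabla1_smul (X : SmoothVF E M) (f : SmoothFun E M) (m : SmoothSec E F₁ A₁) :
    s.nabla1 X (f • m) = f • s.nabla1 X m + vfDeriv X f • m := by
  rw [nabla1, L.act_leibniz, s.ρ_σ]; rfl

theorem nabla1_add_left (X Y : SmoothVF E M) (m : SmoothSec E F₁ A₁) :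
    s.nabla1 (X + Y) m = s.nabla1 X m + s.nabla1 Y m := by
  simp only [nabla1, map_add, LinearMap.add_apply]

theorem nabla1_smul_left (f : SmoothFun E M) (X : SmoothVF E M) (m : SmoothSec E F₁ A₁) :
    s.nabla1 (f • X) m = f • s.nabla1 X m := by
  rw [nabla1, map_smul, L.act_smul]; rfl

theorem γ_self (X : SmoothVF E M) : s.γ ![X, X] = 0 :=
  s.γ.map_eq_zero_of_eq ![X, X] (i := 0) (j := 1) rfl (by decide)

theorem γ_add (X Y Z : SmoothVF E M) : s.γ ![X + Y, Z] = s.γ ![X, Z] + s.γ ![Y, Z] :=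
  s.γ.map_vecCons_add ![Z] X Y

theorem γ_smul (f : SmoothFun E M) (X Y : SmoothVF E M) : s.γ ![f • X, Y] = f • s.γ ![X, Y] :=
  s.γ.map_vecCons_smul ![Y] f X

theorem γ_swap (X Y : SmoothVF E M) : s.γ ![X, Y] = -s.γ ![Y, X] := by
  have h := s.γ.map_swap ![Y, X] (i := 0) (j := 1) (by decide)
  rw [← h]
  congr 1
  funext i
  fin_cases i <;> rfl

theorem γ_neg (X Y : SmoothVF E M) : s.γ ![-X, Y] = -s.γ ![X, Y] := by
  have h := s.γ_smul (-1) X Y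
  rwa [neg_one_smul, neg_one_smul] at h

theorem γ_zero (Y : SmoothVF E M) : s.γ ![0, Y] = 0 := by
  have h := s.γ_smul 0 0 Y
  rwa [zero_smul, zero_smul] at h

theorem γ_sub (X Y Z : SmoothVF E M) : s.γ ![X - Y, Z] = s.γ ![X, Z] - s.γ ![Y, Z] := by
  rw [sub_eq_add_neg, γ_add, γ_neg, sub_eq_add_neg]

theorem γ_add_right (X Y Z : SmoothVF E M) : s.γ ![X, Y + Z] = s.γ ![X, Y] + s.γ ![X, Z] := by
  rw [γ_swap, γ_add, γ_swap s Y, γ_swap s Z, neg_add, neg_neg, neg_neg]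

theorem γ_smul_right (f : SmoothFun E M) (X Y : SmoothVF E M) :
    s.γ ![X, f • Y] = f • s.γ ![X, Y] := by
  rw [γ_swap, γ_smul, γ_swap s Y, smul_neg, neg_neg]

/-- `d_{∇¹}γ`, i.e. `d_{∇¹}γ(X, Y, Z) = ∇¹_X γ(Y, Z) - ∇¹_Y γ(X, Z) + ∇¹_Z γ(X, Y)
- γ([X, Y], Z) + γ([X, Z], Y) - γ([Y, Z], X)`. -/
noncomputable def dγ : SmoothVF E M [⋀^Fin 3]→ₗ[SmoothFun E M] SmoothSec E F₁ A₁ :=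
  altThree
    (fun X Y Z => s.nabla1 X (s.γ ![Y, Z]) - s.nabla1 Y (s.γ ![X, Z]) + s.nabla1 Z (s.γ ![X, Y])
      - s.γ ![vfBracket X Y, Z] + s.γ ![vfBracket X Z, Y] - s.γ ![vfBracket Y Z, X])
    (fun X Y => by
      rw [s.γ_self, vfBracket_self, s.γ_zero, s.nabla1_zero]; abel)
    (fun X Y Z => by
      rw [s.γ_swap Y X, s.nabla1_neg, vfBracket_swap Y X, s.γ_neg]; abel)
    (fun X Y Z => by
      rw [s.γ_swap Z Y, s.nabla1_neg, vfBracket_swap Z Y, s.γ_neg]; abel)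
    (fun X Y Z W => by
      simp only [s.γ_add, s.γ_add_right, s.nabla1_add, s.nabla1_add_left, vfBracket_add_left]; abel)
    (fun f X Y Z => by
      simp only [s.γ_smul, s.γ_smul_right, s.nabla1_smul, s.nabla1_smul_left, vfBracket_smul_left,
        s.γ_sub, smul_add, smul_sub]
      abel)

/-- `I(X, Y, Z) = -d_{∇¹}γ(X, Y, Z) - l₃(σ(X), σ(Y), σ(Z))`. -/
noncomputable def I : SmoothVF E M [⋀^Fin 3]→ₗ[SmoothFun E M] SmoothSec E F₁ A₁ :=
  -s.dγ - L.l3.compLinearMap s.σ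

end Splitting

variable [T2Space M] [SigmaCompactSpace M] [ContMDiffVectorBundle ∞ F₀ A₀ 𝓘(ℝ, E)]
  [ContMDiffVectorBundle ∞ F₁ A₁ 𝓘(ℝ, E)]

/-- `l₁` as a map `A₁ → 𝒢`. -/
noncomputable def l1Ker : SmoothSec E F₁ A₁ →ₗ[SmoothFun E M] L.ker :=
  L.l1.codRestrict L.ker fun m => L.ρ_l1 m

/-- `l₂(a, u)` for `a ∈ Γ(A₀)` and `u ∈ Γ(𝒢)`, as a section of `𝒢`. -/
noncomputable def l2Ker (a : SmoothSec E F₀ A₀) (u : L.ker) : L.ker :=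
  ⟨L.l2 a u, by
    have h := vfBracket_smul_left 0 (L.ρ a) (0 : SmoothFun E M)
    rw [zero_smul, zero_smul, smul_zero, sub_zero] at h
    rw [LinearMap.mem_ker, L.ρ_l2, LinearMap.mem_ker.mp u.2, vfBracket_swap, h, neg_zero]⟩

namespace Splitting

variable {L} (s : L.Splitting)

/-- `(X, Y) ↦ σ[X, Y] - l₂(σ(X), σ(Y))`, with values in `𝒢`. -/
noncomputable def curvAux : SmoothVF E M [⋀^Fin 2]→ₗ[SmoothFun E M] L.ker :=
  altTwo
    (fun X Y => ⟨s.σ (vfBracket X Y) - L.l2 (s.σ X) (s.σ Y), by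
      rw [LinearMap.mem_ker, map_sub, L.ρ_l2, s.ρ_σ, s.ρ_σ, s.ρ_σ, sub_self]⟩)
    (fun X => by ext1; simp [vfBracket_self, L.l2_self])
    (fun X Y => by
      ext1
      simp only [Submodule.coe_neg]
      rw [vfBracket_swap, L.l2_swap, map_neg]; abel)
    (fun X Y Z => by
      ext1
      simp only [Submodule.coe_add, vfBracket_add_left, map_add, LinearMap.add_apply]; abel)
    (fun f X Y => by
      ext1
      simp only [Submodule.coe_smul, vfBracket_smul_left, map_sub, map_smul]
      rw [L.l2_swap, L.l2_leibniz, L.l2_swap (s.σ Y), s.ρ_σ, smul_sub, smul_neg]; abel)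

/-- `R(X, Y) = σ[X, Y] - l₂(σ(X), σ(Y)) - l₁ γ(X, Y)`. -/
noncomputable def R : SmoothVF E M [⋀^Fin 2]→ₗ[SmoothFun E M] L.ker :=
  s.curvAux - L.l1Ker.compAlternatingMap s.γ

theorem coe_R (X Y : SmoothVF E M) : (s.R ![X, Y] : SmoothSec E F₀ A₀) =
    s.σ (vfBracket X Y) - L.l2 (s.σ X) (s.σ Y) - L.l1 (s.γ ![X, Y]) := rfl

/-- The curvature `R_γ = R + l₁ ∘ γ`. -/
noncomputable def Rγ : SmoothVF E M [⋀^Fin 2]→ₗ[SmoothFun E M] L.ker :=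
  s.R + L.l1Ker.compAlternatingMap s.γ

/-- The curvature `I_γ = I + d_{∇¹}γ`. -/
noncomputable def Iγ : SmoothVF E M [⋀^Fin 3]→ₗ[SmoothFun E M] SmoothSec E F₁ A₁ :=
  s.I + s.dγ

end Splitting

end LieTwoAlgebroid

/-- A quadratic Lie 2-algebroid: a transitive Lie 2-algebroid with a nondegenerate graded symmetric
bilinear form `S` of degree `1` on `A₁ ⊕ 𝒢`, `𝒢 = ker ρ`, satisfying the invariance conditions. For
degree reasons and by symmetry `S` is determined by the pairing of `𝒢` with `A₁`. -/
structure QuadraticLieTwoAlgebroid (E : Type*) [NormedAddCommGroup E] [NormedSpace ℝ E]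
    [FiniteDimensional ℝ E] {M : Type*} [TopologicalSpace M] [ChartedSpace E M]
    [IsManifold 𝓘(ℝ, E) ∞ M] [T2Space M] [SigmaCompactSpace M]
    (F₀ : Type*) [NormedAddCommGroup F₀] [NormedSpace ℝ F₀]
    (A₀ : M → Type*) [TopologicalSpace (TotalSpace F₀ A₀)] [∀ x, TopologicalSpace (A₀ x)]
    [FiberBundle F₀ A₀] [∀ x, AddCommGroup (A₀ x)] [∀ x, Module ℝ (A₀ x)] [VectorBundle ℝ F₀ A₀]
    [ContMDiffVectorBundle ∞ F₀ A₀ 𝓘(ℝ, E)]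
    (F₁ : Type*) [NormedAddCommGroup F₁] [NormedSpace ℝ F₁]
    (A₁ : M → Type*) [TopologicalSpace (TotalSpace F₁ A₁)] [∀ x, TopologicalSpace (A₁ x)]
    [FiberBundle F₁ A₁] [∀ x, AddCommGroup (A₁ x)] [∀ x, Module ℝ (A₁ x)] [VectorBundle ℝ F₁ A₁]
    [ContMDiffVectorBundle ∞ F₁ A₁ 𝓘(ℝ, E)]
    extends LieTwoAlgebroid E F₀ A₀ F₁ A₁ where
  /-- the anchor is fibrewise surjective -/
  transitive : ∀ (x : M) (v : TangentSpace 𝓘(ℝ, E) x), ∃ a : SmoothSec E F₀ A₀, ρ a x = v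
  /-- the pairing `S(u, m)` of `u ∈ Γ(𝒢)` with `m ∈ Γ(A₁)` -/
  S : toLieTwoAlgebroid.ker →ₗ[SmoothFun E M] SmoothSec E F₁ A₁ →ₗ[SmoothFun E M] SmoothFun E M
  /-- nondegeneracy on each fibre, in the first argument -/
  S_nondegenerate_left : ∀ (x : M) u, (∀ m, S u m x = 0) → (u : SmoothSec E F₀ A₀) x = 0
  /-- nondegeneracy on each fibre, in the second argument -/
  S_nondegenerate_right : ∀ (x : M) m, (∀ u, S u m x = 0) → m x = 0
  S_l1 : ∀ m p, S (toLieTwoAlgebroid.l1Ker m) p = S (toLieTwoAlgebroid.l1Ker p) m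
  S_l2 : ∀ a u m, vfDeriv (ρ a) (S u m) = S (toLieTwoAlgebroid.l2Ker a u) m + S u (act a m)
  S_l3 : ∀ (a b : SmoothSec E F₀ A₀) (u v : toLieTwoAlgebroid.ker),
    S v (l3 ![a, b, u]) = -S u (l3 ![a, b, v])

namespace QuadraticLieTwoAlgebroid

variable [T2Space M] [SigmaCompactSpace M]
  {F₀ : Type*} [NormedAddCommGroup F₀] [NormedSpace ℝ F₀]
  {A₀ : M → Type*} [TopologicalSpace (TotalSpace F₀ A₀)] [∀ x, TopologicalSpace (A₀ x)]
  [FiberBundle F₀ A₀] [∀ x, AddCommGroup (A₀ x)] [∀ x, Module ℝ (A₀ x)] [VectorBundle ℝ F₀ A₀]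
  [ContMDiffVectorBundle ∞ F₀ A₀ 𝓘(ℝ, E)]
  {F₁ : Type*} [NormedAddCommGroup F₁] [NormedSpace ℝ F₁]
  {A₁ : M → Type*} [TopologicalSpace (TotalSpace F₁ A₁)] [∀ x, TopologicalSpace (A₁ x)]
  [FiberBundle F₁ A₁] [∀ x, AddCommGroup (A₁ x)] [∀ x, Module ℝ (A₁ x)] [VectorBundle ℝ F₁ A₁]
  [ContMDiffVectorBundle ∞ F₁ A₁ 𝓘(ℝ, E)]
  (Q : QuadraticLieTwoAlgebroid E F₀ A₀ F₁ A₁)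

/-- Splittings of the underlying transitive Lie 2-algebroid. -/
abbrev Splitting : Type _ := Q.toLieTwoAlgebroid.Splitting

/-- The 5-form `S(R_γ, I_γ)`. -/
noncomputable def formRγIγ (s : Q.Splitting) : DiffForm E M 5 :=
  pairForm Q.S s.Rγ s.Iγ

/-- The 5-form `S(R, I)`. -/
noncomputable def formRI (s : Q.Splitting) : DiffForm E M 5 :=
  pairForm Q.S s.R s.I

end QuadraticLieTwoAlgebroid

end Algebroid
end Geometry

set_option linter.unusedSectionVars false

/-! Write `∇` for the connections on `𝒢 = ker ρ` and on `A₁` induced by `l₂(σ(X), ·)`. The two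
occurrences of `γ` in `R_γ` and `I_γ` cancel: `R_γ(X, Y) = σ[X, Y] - l₂(σX, σY)` and `I_γ = -l₃(σ,
σ, σ)` depend only on `σ`. So does the form `S(R_γ, I_γ)`, which settles independence of `γ`.

Closedness. The invariance of `S` says that `S` is parallel, so `d S(Ξ, Π) = S(d_∇ Ξ, Π) ± S(Ξ, d_∇
Π)` (`cochainD_wedge`). The Jacobi identity up to `l₃` gives `d_∇ R_γ = l₁ I_γ` (`cochainD_Rγ`), and
the jacobiator identity turns `d_∇ I_γ` into the alternating sum of `l₃(R_γ, σ, σ)`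
(`cochainD_Iγ_apply`). Hence `d S(R_γ, I_γ) = S(l₁ I_γ, I_γ) + S(R_γ, d_∇ I_γ)`. The first term
vanishes because `S(l₁ m, p)` is symmetric while forms of degree three anticommute; the second
because `S(u, l₃(v, a, b))` is skew in `u, v` while forms of degree two commute.

Comparison with `S(R, I)`. Since `R = R_γ - l₁ γ` and `I = I_γ - d_∇ γ`, the same rules show that
`S(R, I) - S(R_γ, I_γ)` is the differential of `½ S(l₁ γ, γ) - S(R_γ, γ)` (`formRI_sub_formRγIγ`).

Independence of `σ`. Two splittings differ by a `𝒢`-valued one-form `B`. Along `σ + tB` the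
derivative of `S(R_γ, I_γ)` is `-dη(t)` with `η(t) = S(B, I_γ(t))` (`extDer_transgression`,
`formRγIγ_shift`). As `dη(t)` is a cubic polynomial in `t`, Simpson's rule computes its integral
over `[0, 1]` exactly, so the difference is `d` of an explicit combination of `η(0)`, `η(1/2)`,
`η(1)` and no form has to be integrated.

The calculus is done on functions of lists of vectors. There the contraction rules for `d` and for
the wedge product are the definitions, and the graded identities follow by induction on the list. -/

section Cochains

/-! Calculus of inhomogeneous cochains `List V → N`. -/

variable {V N N₁ N₂ : Type*} [AddCommGroup N] [AddCommGroup N₁] [AddCommGroup N₂]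

/-- Contraction with `X`. -/
def cochainInsert (X : V) (α : List V → N) : List V → N := fun l => α (X :: l)

/-- The grading involution. -/
def cochainSign (α : List V → N) : List V → N := fun l => (-1 : ℤ) ^ l.length • α l

/-- The Lie derivative along `X` with respect to a bracket and a connection. -/
def cochainLie (br : V → V → V) (D : V → N →+ N) (X : V) : List V → (List V → N) → N
  | [], α => D X (α [])
  | Y :: l, α => cochainLie br D X l (cochainInsert Y α) - α (br X Y :: l)

/-- The exterior covariant derivative, defined recursively by Cartan's formula. -/
def cochainD (br : V → V → V) (D : V → N →+ N) : List V → (List V → N) → N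
  | [], _ => 0
  | X :: l, α => cochainLie br D X l α - cochainD br D l (cochainInsert X α)

/-- The wedge product with respect to a biadditive pairing. -/
def cochainWedge (B : N₁ →+ N₂ →+ N) : List V → (List V → N₁) → (List V → N₂) → N
  | [], α, β => B (α []) (β [])
  | X :: l, α, β => cochainWedge B l (cochainInsert X α) β +
      cochainWedge B l (cochainSign α) (cochainInsert X β)

theorem cochainInsert_add (X : V) (α β : List V → N) :
    cochainInsert X (α + β) = cochainInsert X α + cochainInsert X β := rfl

theorem cochainInsert_sign (X : V) (α : List V → N) :
    cochainInsert X (cochainSign α) = -cochainSign (cochainInsert X α) := by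
  funext l
  simp [cochainInsert, cochainSign, pow_succ]

theorem cochainSign_add (α β : List V → N) :
    cochainSign (α + β) = cochainSign α + cochainSign β := by
  funext l; simp [cochainSign]

theorem cochainSign_sign (α : List V → N) : cochainSign (cochainSign α) = α := by
  funext l
  rw [cochainSign, cochainSign, smul_smul, ← mul_pow]
  simp

section Derivative
variable (br : V → V → V) (D : V → N →+ N)

theorem cochainLie_add (X : V) (l : List V) (α β : List V → N) :
    cochainLie br D X l (α + β) = cochainLie br D X l α + cochainLie br D X l β := by
  induction l generalizing α β with
  | nil => simp [cochainLie]
  | cons Y l ih => simp only [cochainLie, cochainInsert_add, ih, Pi.add_apply]; abel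

theorem cochainD_add (l : List V) (α β : List V → N) :
    cochainD br D l (α + β) = cochainD br D l α + cochainD br D l β := by
  induction l generalizing α β with
  | nil => simp [cochainD]
  | cons Y l ih => simp only [cochainD, cochainInsert_add, ih, cochainLie_add]; abel

theorem cochainLie_neg (X : V) (l : List V) (α : List V → N) :
    cochainLie br D X l (-α) = -cochainLie br D X l α :=
  map_neg (AddMonoidHom.mk' (cochainLie br D X l) (cochainLie_add br D X l)) α

theorem cochainD_neg (l : List V) (α : List V → N) :
    cochainD br D l (-α) = -cochainD br D l α :=
  map_neg (AddMonoidHom.mk' (cochainD br D l) (cochainD_add br D l)) α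

theorem cochainD_sub (l : List V) (α β : List V → N) :
    cochainD br D l (α - β) = cochainD br D l α - cochainD br D l β :=
  map_sub (AddMonoidHom.mk' (cochainD br D l) (cochainD_add br D l)) α β

theorem cochainLie_sub (X : V) (l : List V) (α β : List V → N) :
    cochainLie br D X l (α - β) = cochainLie br D X l α - cochainLie br D X l β :=
  map_sub (AddMonoidHom.mk' (cochainLie br D X l) (cochainLie_add br D X l)) α β

/-- The Lie derivative preserves degree, so it commutes with the grading involution; `cochainD`
raises degree by one, whence the extra minus sign in `cochainD_sign`. -/
theorem cochainLie_sign (X : V) (l : List V) (α : List V → N) :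
    cochainLie br D X l (cochainSign α) = (-1 : ℤ) ^ l.length • cochainLie br D X l α := by
  induction l generalizing α with
  | nil => simp [cochainLie, cochainSign]
  | cons Y l ih =>
    simp only [cochainLie, cochainInsert_sign, cochainLie_neg, ih, List.length_cons, pow_succ,
      cochainSign, mul_neg_one, neg_smul, smul_sub]

theorem cochainD_sign (l : List V) (α : List V → N) :
    cochainD br D l (cochainSign α) = -((-1 : ℤ) ^ l.length • cochainD br D l α) := by
  induction l generalizing α with
  | nil => simp [cochainD]
  | cons Y l ih =>
    simp only [cochainD, cochainInsert_sign, cochainD_neg, ih, cochainLie_sign, List.length_cons,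
      pow_succ, mul_neg_one, neg_smul, smul_sub]
    abel

theorem cochainInsert_lie (X Y : V) (α : List V → N) :
    cochainInsert Y (fun l => cochainLie br D X l α) =
      (fun l => cochainLie br D X l (cochainInsert Y α)) - cochainInsert (br X Y) α := rfl

theorem cochainInsert_d (X : V) (α : List V → N) :
    cochainInsert X (fun l => cochainD br D l α) =
      (fun l => cochainLie br D X l α) - fun l => cochainD br D l (cochainInsert X α) := rfl

end Derivative

section Wedge
variable (B : N₁ →+ N₂ →+ N)

theorem cochainWedge_add_left (l : List V) (α α' : List V → N₁) (β : List V → N₂) :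
    cochainWedge B l (α + α') β = cochainWedge B l α β + cochainWedge B l α' β := by
  induction l generalizing α α' β with
  | nil => simp [cochainWedge]
  | cons Y l ih => simp only [cochainWedge, cochainInsert_add, cochainSign_add, ih]; abel

theorem cochainWedge_add_right (l : List V) (α : List V → N₁) (β β' : List V → N₂) :
    cochainWedge B l α (β + β') = cochainWedge B l α β + cochainWedge B l α β' := by
  induction l generalizing α β β' with
  | nil => simp [cochainWedge]
  | cons Y l ih => simp only [cochainWedge, cochainInsert_add, ih]; abel

theorem cochainWedge_neg_left (l : List V) (α : List V → N₁) (β : List V → N₂) :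
    cochainWedge B l (-α) β = -cochainWedge B l α β :=
  map_neg (AddMonoidHom.mk' (fun α => cochainWedge B l α β)
    (fun α α' => cochainWedge_add_left B l α α' β)) α

theorem cochainWedge_neg_right (l : List V) (α : List V → N₁) (β : List V → N₂) :
    cochainWedge B l α (-β) = -cochainWedge B l α β :=
  map_neg (AddMonoidHom.mk' (fun β => cochainWedge B l α β)
    (fun β β' => cochainWedge_add_right B l α β β')) β

theorem cochainWedge_sub_left (l : List V) (α α' : List V → N₁) (β : List V → N₂) :
    cochainWedge B l (α - α') β = cochainWedge B l α β - cochainWedge B l α' β := by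
  rw [sub_eq_add_neg, cochainWedge_add_left, cochainWedge_neg_left, sub_eq_add_neg]

theorem cochainWedge_sub_right (l : List V) (α : List V → N₁) (β β' : List V → N₂) :
    cochainWedge B l α (β - β') = cochainWedge B l α β - cochainWedge B l α β' := by
  rw [sub_eq_add_neg, cochainWedge_add_right, cochainWedge_neg_right, sub_eq_add_neg]

variable (br : V → V → V) {D : V → N →+ N} {D₁ : V → N₁ →+ N₁} {D₂ : V → N₂ →+ N₂}

/-- A pairing that is parallel for the three connections makes `L_X` a derivation of the wedge
product. No flatness is needed, here or in `cochainD_wedge`, so both apply to connections with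
curvature. -/
theorem cochainLie_wedge
    (hB : ∀ X m n, D X (B m n) = B (D₁ X m) n + B m (D₂ X n))
    (X : V) (l : List V) (α : List V → N₁) (β : List V → N₂) :
    cochainLie br D X l (fun l => cochainWedge B l α β) =
      cochainWedge B l (fun l => cochainLie br D₁ X l α) β +
      cochainWedge B l α (fun l => cochainLie br D₂ X l β) := by
  induction l generalizing α β with
  | nil => simp [cochainWedge, cochainLie, hB]
  | cons Y l ih =>
    have h1 : cochainInsert Y (fun l => cochainWedge B l α β) =
        (fun l => cochainWedge B l (cochainInsert Y α) β) +
        (fun l => cochainWedge B l (cochainSign α) (cochainInsert Y β)) := rfl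
    have h2 : (fun l => cochainLie br D₁ X l (cochainSign α)) =
        cochainSign (fun l => cochainLie br D₁ X l α) :=
      funext fun l => cochainLie_sign br D₁ X l α
    simp only [cochainLie, h1, cochainLie_add, ih, h2, cochainWedge, cochainInsert_lie,
      cochainWedge_sub_left, cochainWedge_sub_right]
    abel

/-- Contract with the first vector: Cartan's formula on both sides and the derivation property of
`L_X` reduce the claim to shorter lists. The grading involution carries the sign `(-1)^|α|`, so
inhomogeneous cochains are allowed. -/
theorem cochainD_wedge
    (hB : ∀ X m n, D X (B m n) = B (D₁ X m) n + B m (D₂ X n))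
    (l : List V) (α : List V → N₁) (β : List V → N₂) :
    cochainD br D l (fun l => cochainWedge B l α β) =
      cochainWedge B l (fun l => cochainD br D₁ l α) β +
      cochainWedge B l (cochainSign α) (fun l => cochainD br D₂ l β) := by
  induction l generalizing α β with
  | nil => simp [cochainWedge, cochainD]
  | cons X l ih =>
    have h1 : cochainInsert X (fun l => cochainWedge B l α β) =
        (fun l => cochainWedge B l (cochainInsert X α) β) +
        (fun l => cochainWedge B l (cochainSign α) (cochainInsert X β)) := rfl
    have h2 : (fun l => cochainD br D₁ l (cochainSign α)) =
        -cochainSign (fun l => cochainD br D₁ l α) :=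
      funext fun l => cochainD_sign br D₁ l α
    simp only [cochainD, h1, cochainD_add, ih, h2, cochainLie_wedge B br hB, cochainWedge,
      cochainInsert_d, cochainInsert_sign, cochainSign_sign, cochainWedge_sub_left,
      cochainWedge_sub_right, cochainWedge_neg_left]
    abel

end Wedge

section Square
variable [AddCommGroup V] {br : V → V → V} {D : V → N →+ N}

/-- Cochains that are additive in each argument. -/
def IsAdditiveCochain (α : List V → N) : Prop :=
  ∀ l l' X Y, α (l ++ (X + Y) :: l') = α (l ++ X :: l') + α (l ++ Y :: l')

theorem IsAdditiveCochain.insert {α : List V → N} (h : IsAdditiveCochain α) (X : V) :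
    IsAdditiveCochain (cochainInsert X α) := fun l => h (X :: l)

/-- Flatness is the case of degree zero. In the inductive step the corrections `i_[X, Z]` from
commuting `i_Z` past `L_X` match by the Jacobi identity; additivity of the cochain is used only to
split it along that identity. -/
theorem cochainLie_bracket
    (jac : ∀ X Y Z, br X (br Y Z) = br (br X Y) Z + br Y (br X Z))
    (flat : ∀ X Y n, D (br X Y) n = D X (D Y n) - D Y (D X n))
    (X Y : V) (l : List V) {α : List V → N} (h : IsAdditiveCochain α) :
    cochainLie br D (br X Y) l α = cochainLie br D X l (fun l => cochainLie br D Y l α) -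
      cochainLie br D Y l (fun l => cochainLie br D X l α) := by
  induction l generalizing α with
  | nil => simp [cochainLie, flat]
  | cons Z l ih =>
    have h1 : α (br X (br Y Z) :: l) = α (br (br X Y) Z :: l) + α (br Y (br X Z) :: l) := by
      rw [jac]; exact h [] l _ _
    simp only [cochainLie, cochainInsert_lie, cochainLie_sub, ih (h.insert Z), h1]
    abel

/-- Contracting with `Y` replaces `i_Y d` by `L_Y - d i_Y`; what remains is `L_[X, Y] = L_X L_Y -
L_Y L_X` and the claim on a shorter list. -/
theorem cochainLie_d
    (jac : ∀ X Y Z, br X (br Y Z) = br (br X Y) Z + br Y (br X Z))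
    (flat : ∀ X Y n, D (br X Y) n = D X (D Y n) - D Y (D X n))
    (X : V) (l : List V) {α : List V → N} (h : IsAdditiveCochain α) :
    cochainLie br D X l (fun l => cochainD br D l α) =
      cochainD br D l (fun l => cochainLie br D X l α) := by
  induction l generalizing α with
  | nil => simp [cochainLie, cochainD]
  | cons Y l ih =>
    simp only [cochainLie, cochainD, cochainInsert_lie, cochainInsert_d, cochainLie_sub,
      cochainD_sub, ih (h.insert Y), cochainLie_bracket jac flat X Y l h]
    abel

/-- By Cartan's formula, `i_X d d = L_X d - d L_X + d d i_X`, where `L_X` commutes with `d` and the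
last term is covered by induction. -/
theorem cochainD_d
    (jac : ∀ X Y Z, br X (br Y Z) = br (br X Y) Z + br Y (br X Z))
    (flat : ∀ X Y n, D (br X Y) n = D X (D Y n) - D Y (D X n))
    (l : List V) {α : List V → N} (h : IsAdditiveCochain α) :
    cochainD br D l (fun l => cochainD br D l α) = 0 := by
  induction l generalizing α with
  | nil => rfl
  | cons X l ih =>
    simp only [cochainD, cochainInsert_d, cochainD_sub, ih (h.insert X), cochainLie_d jac flat X l
      h]
    abel

end Square

end Cochains

/-! ### Alternating forms as homogeneous cochains. -/

section AlternatingCochains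

variable {R V N : Type*} [CommRing R] [AddCommGroup V] [Module R V] [AddCommGroup N] [Module R N]

/-- An alternating form as a cochain concentrated in one degree. -/
def altCochain {k : ℕ} (α : V [⋀^Fin k]→ₗ[R] N) (l : List V) : N :=
  if h : l.length = k then α fun i => l.get (i.cast h.symm) else 0

theorem altCochain_ofFn {k : ℕ} (α : V [⋀^Fin k]→ₗ[R] N) (X : Fin k → V) :
    altCochain α (List.ofFn X) = α X := by
  rw [altCochain, dif_pos (List.length_ofFn)]
  congr 1
  funext i
  simp

theorem altCochain_eq_zero {k : ℕ} (α : V [⋀^Fin k]→ₗ[R] N) {l : List V} (h : l.length ≠ k) :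
    altCochain α l = 0 := dif_neg h

theorem altCochain_cons {k : ℕ} (α : V [⋀^Fin (k + 1)]→ₗ[R] N) (X : V) (l : List V) :
    altCochain α (X :: l) = altCochain (α.curryLeft X) l := by
  by_cases h : l.length = k
  · subst h
    rw [altCochain, altCochain, dif_pos (List.length_cons), dif_pos rfl]
    rw [AlternatingMap.curryLeft_apply_apply]
    congr 1
    funext i
    refine Fin.cases ?_ (fun j => ?_) i <;> rfl
  · rw [altCochain_eq_zero _ h, altCochain_eq_zero]
    simpa using h

theorem altCochain_insert {k : ℕ} (α : V [⋀^Fin (k + 1)]→ₗ[R] N) (X : V) :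
    cochainInsert X (altCochain α) = altCochain (α.curryLeft X) :=
  funext (altCochain_cons α X)

theorem isAdditiveCochain_altCochain {k : ℕ} (α : V [⋀^Fin k]→ₗ[R] N) :
    IsAdditiveCochain (altCochain α) := by
  intro l l' X Y
  induction l generalizing k with
  | nil =>
    cases k with
    | zero => simp [altCochain]
    | succ k =>
      simp only [List.nil_append, altCochain_cons, map_add]
      unfold altCochain
      split_ifs <;> simp
  | cons Z l ih =>
    cases k with
    | zero => simp [altCochain]
    | succ k => simp only [List.cons_append, altCochain_cons, ih]

end AlternatingCochains

/-! ### The explicit exterior derivative agrees with the recursive one. -/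

section ExteriorDerivative

variable {E : Type*} [NormedAddCommGroup E] [NormedSpace ℝ E] [FiniteDimensional ℝ E]
  {M : Type*} [TopologicalSpace M] [ChartedSpace E M] [IsManifold 𝓘(ℝ, E) ∞ M]

/-- The derivation of functions along a vector field, as an additive map. -/
noncomputable def vfDerivHom (X : SmoothVF E M) : SmoothFun E M →+ SmoothFun E M :=
  AddMonoidHom.mk' (vfDeriv X) (vfDeriv_add X)

theorem cochainLie_altCochain {k : ℕ} (α : DiffForm E M k) (X : SmoothVF E M)
    (Y : Fin k → SmoothVF E M) :
    cochainLie vfBracket vfDerivHom X (List.ofFn Y) (altCochain α) =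
      vfDeriv X (α Y) - ∑ j, α (Function.update Y j (vfBracket X (Y j))) := by
  induction k with
  | zero =>
    have h := altCochain_ofFn α Y
    rw [List.ofFn_zero] at h
    simp [cochainLie, h, vfDerivHom]
  | succ k ih =>
    rw [List.ofFn_succ, cochainLie, altCochain_insert, ih, altCochain_cons, altCochain_ofFn,
      Fin.sum_univ_succ]
    have h1 : ∀ Z : Fin k → SmoothVF E M, ∀ W, Matrix.vecCons W Z = Fin.cons W Z := fun _ _ => rfl
    have h2 : Fin.cons (Y 0) (fun i => Y (Fin.succ i)) = Y := Fin.cons_self_tail Y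
    have h3 : ∀ (j : Fin k) W, Fin.cons (Y 0) (Function.update (fun i => Y (Fin.succ i)) j W) =
        Function.update Y j.succ W := fun j W => by
      rw [Fin.cons_update, h2]
    have h4 : ∀ W, Fin.cons W (fun i => Y (Fin.succ i)) = Function.update Y 0 W := fun W => by
      rw [← h2, Fin.update_cons_zero, h2]
    simp only [AlternatingMap.curryLeft_apply_apply, h1, h2, h3, h4]
    abel

/-- Split the explicit formula by whether the first index is `0`: the terms `X₀(α(…))` and `[X₀,
X_j]` assemble to the Lie derivative along `X₀`, and all others keep `X₀` as first argument and form
`-d(i_{X₀} α)`. -/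
theorem extDer_eq_cochainD {k : ℕ} (α : DiffForm E M k) (X : Fin (k + 1) → SmoothVF E M) :
    extDer α X = cochainD vfBracket vfDerivHom (List.ofFn X) (altCochain α) := by
  induction k with
  | zero =>
    have h := altCochain_ofFn α (fun l => X ((0 : Fin 1).succAbove l))
    rw [List.ofFn_zero] at h
    simp [extDer, cochainD, cochainLie, h, vfDerivHom]
  | succ k ih =>
    have h1 : ∀ Z : Fin k → SmoothVF E M, ∀ W, Matrix.vecCons W Z = Fin.cons W Z := fun _ _ => rfl
    have h2 : ∀ j : Fin (k + 1), (fun l => X (j.succ.succAbove l)) =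
        Matrix.vecCons (X 0) (fun l => X (j.succAbove l).succ) := fun j => by
      funext l
      refine Fin.cases ?_ (fun l => ?_) l <;> simp
    have h3 : ∀ (i j : Fin (k + 1)) W,
        (fun l => Function.update X i.succ W (j.succ.succAbove l)) =
        Matrix.vecCons (X 0) (fun l =>
          Function.update (fun i : Fin (k + 1) => X i.succ) i W (j.succAbove l)) := fun i j W => by
      funext l
      refine Fin.cases ?_ (fun l => ?_) l
      · simp [Function.update, (Fin.succ_ne_zero i).symm]
      · simp [Function.update]
    -- The bracket `[X₀, X_j]` sits in the slot of `X₀`; carrying it to the vacated slot of `X_j`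
    -- passes `j` arguments and absorbs the sign `(-1)^j`.
    have h4 : ∀ (j : Fin (k + 1)) W,
        (-1 : ℤ) ^ (j : ℕ) • α (fun l => Function.update X 0 W (j.succ.succAbove l)) =
        α (Function.update (fun i : Fin (k + 1) => X i.succ) j W) := fun j W => by
      have e1 : (fun l => Function.update X 0 W (j.succ.succAbove l)) =
          Matrix.vecCons W (fun l => X (j.succAbove l).succ) := by
        funext l
        refine Fin.cases ?_ (fun l => ?_) l <;> simp [Function.update]
      have e2 : Function.update (fun i : Fin (k + 1) => X i.succ) j W =
          j.insertNth W (fun l => X (j.succAbove l).succ) := by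
        rw [Fin.eq_insertNth_iff]
        refine ⟨by simp, ?_⟩
        funext l
        simp [Fin.removeNth]
      rw [e1, e2, AlternatingMap.map_insertNth]
    rw [List.ofFn_succ, cochainD, altCochain_insert, cochainLie_altCochain, ← ih, extDer, extDer,
      Fin.sum_univ_succ, Fin.sum_univ_succ (n := k + 1), Fin.sum_Ioi_zero]
    simp only [Fin.sum_Ioi_succ, h2, h3, AlternatingMap.curryLeft_apply_apply, Fin.val_succ,
      pow_succ, mul_neg_one, neg_smul, Finset.sum_neg_distrib, h4, Fin.val_zero, pow_zero, one_smul,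
      Fin.succAbove_zero]
    abel

end ExteriorDerivative

/-! ### Permutation sums reduced to shuffle sums. -/

section PairForm

/-- The alternating sum of a function over all permutations of its arguments. -/
def altSum {V N : Type*} [AddCommGroup N] {n : ℕ} (H : (Fin n → V) → N) (X : Fin n → V) : N :=
  ∑ τ : Equiv.Perm (Fin n), Equiv.Perm.sign τ • H fun i => X (τ i)

/-- `decomposeFin` writes a permutation uniquely as the transposition of `0` and `p` composed with a
permutation fixing `0`. The transposition is odd unless `p = 0`. -/
theorem altSum_succ {V N : Type*} [AddCommGroup N] {n : ℕ} (H : (Fin (n + 1) → V) → N)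
    (X : Fin (n + 1) → V) :
    altSum H X = ∑ p : Fin (n + 1), (if p = 0 then (1 : ℤˣ) else -1) •
      altSum (fun Y => H (Matrix.vecCons (X p) Y)) fun i => X (Equiv.swap 0 p i.succ) := by
  simp only [altSum, Finset.smul_sum, smul_smul]
  rw [← Equiv.sum_comp Equiv.Perm.decomposeFin.symm, Fintype.sum_prod_type]
  refine Finset.sum_congr rfl fun p _ => Finset.sum_congr rfl fun e _ => ?_
  rw [Equiv.Perm.decomposeFin.symm_sign]
  congr 2
  funext i
  refine Fin.cases ?_ (fun j => ?_) i <;> simp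

theorem altSum_one {V N : Type*} [AddCommGroup N] (H : (Fin 1 → V) → N) (a : V) :
    altSum H ![a] = H ![a] := by
  simp only [altSum, Fintype.sum_unique]
  simp only [Equiv.Perm.default_eq, map_one, one_smul, Equiv.Perm.coe_one, id_eq]

theorem altSum_two {V N : Type*} [AddCommGroup N] (H : (Fin 2 → V) → N) (a b : V) :
    altSum H ![a, b] = H ![a, b] - H ![b, a] := by
  have h1 : (fun i : Fin 1 => ![a, b] (Equiv.swap 0 1 i.succ)) = ![a] := by
    funext i; fin_cases i; rfl
  have h2 : (fun _ : Fin 1 => b) = ![b] := by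
    funext i; fin_cases i; rfl
  simp [altSum_succ H, Fin.sum_univ_succ, h1, h2, altSum_one, sub_eq_add_neg]

theorem altSum_three {V N : Type*} [AddCommGroup N] (H : (Fin 3 → V) → N) (a b c : V) :
    altSum H ![a, b, c] = altSum (fun Y => H (Matrix.vecCons a Y)) ![b, c] -
      altSum (fun Y => H (Matrix.vecCons b Y)) ![a, c] -
      altSum (fun Y => H (Matrix.vecCons c Y)) ![b, a] := by
  have h1 : (fun i : Fin 2 => ![a, b, c] (Equiv.swap 0 1 i.succ)) = ![a, c] := by
    funext i; fin_cases i <;> rfl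
  have h2 : (fun i : Fin 2 => ![a, b, c] (Equiv.swap 0 2 i.succ)) = ![b, a] := by
    funext i; fin_cases i <;> rfl
  rw [altSum_succ H]
  simp [Fin.sum_univ_succ, h1, h2, sub_eq_add_neg, add_assoc]
  abel

theorem altSum_four {V N : Type*} [AddCommGroup N] (H : (Fin 4 → V) → N) (a b c d : V) :
    altSum H ![a, b, c, d] = altSum (fun Y => H (Matrix.vecCons a Y)) ![b, c, d] -
      altSum (fun Y => H (Matrix.vecCons b Y)) ![a, c, d] -
      altSum (fun Y => H (Matrix.vecCons c Y)) ![b, a, d] -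
      altSum (fun Y => H (Matrix.vecCons d Y)) ![b, c, a] := by
  have h1 : (fun i : Fin 3 => ![a, b, c, d] (Equiv.swap 0 1 i.succ)) = ![a, c, d] := by
    funext i; fin_cases i <;> rfl
  have h2 : (fun i : Fin 3 => ![a, b, c, d] (Equiv.swap 0 2 i.succ)) = ![b, a, d] := by
    funext i; fin_cases i <;> rfl
  have h3 : (fun i : Fin 3 => ![a, b, c, d] (Equiv.swap 0 3 i.succ)) = ![b, c, a] := by
    funext i; fin_cases i <;> rfl
  rw [altSum_succ H]
  simp [Fin.sum_univ_succ, h1, h2, h3, sub_eq_add_neg, add_assoc]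
  abel

theorem altSum_five {V N : Type*} [AddCommGroup N] (H : (Fin 5 → V) → N) (a b c d e : V) :
    altSum H ![a, b, c, d, e] = altSum (fun Y => H (Matrix.vecCons a Y)) ![b, c, d, e] -
      altSum (fun Y => H (Matrix.vecCons b Y)) ![a, c, d, e] -
      altSum (fun Y => H (Matrix.vecCons c Y)) ![b, a, d, e] -
      altSum (fun Y => H (Matrix.vecCons d Y)) ![b, c, a, e] -
      altSum (fun Y => H (Matrix.vecCons e Y)) ![b, c, d, a] := by
  have h1 : (fun i : Fin 4 => ![a, b, c, d, e] (Equiv.swap 0 1 i.succ)) = ![a, c, d, e] := by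
    funext i; fin_cases i <;> rfl
  have h2 : (fun i : Fin 4 => ![a, b, c, d, e] (Equiv.swap 0 2 i.succ)) = ![b, a, d, e] := by
    funext i; fin_cases i <;> rfl
  have h3 : (fun i : Fin 4 => ![a, b, c, d, e] (Equiv.swap 0 3 i.succ)) = ![b, c, a, e] := by
    funext i; fin_cases i <;> rfl
  have h4 : (fun i : Fin 4 => ![a, b, c, d, e] (Equiv.swap 0 4 i.succ)) = ![b, c, d, a] := by
    funext i; fin_cases i <;> rfl
  rw [altSum_succ H]
  simp [Fin.sum_univ_succ, h1, h2, h3, h4, sub_eq_add_neg, add_assoc]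
  abel

variable {R V N : Type*} [CommRing R] [AddCommGroup V] [Module R V] [AddCommGroup N] [Module R N]

theorem AlternatingMap.map_pair_swap (α : V [⋀^Fin 2]→ₗ[R] N) (a b : V) :
    α ![b, a] = -α ![a, b] := by
  rw [← α.map_swap ![a, b] (i := 0) (j := 1) (by decide)]
  congr 1; funext i; fin_cases i <;> rfl

theorem AlternatingMap.map_triple_swap_left (α : V [⋀^Fin 3]→ₗ[R] N) (a b c : V) :
    α ![b, a, c] = -α ![a, b, c] := by
  rw [← α.map_swap ![a, b, c] (i := 0) (j := 1) (by decide)]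
  congr 1; funext i; fin_cases i <;> rfl

theorem AlternatingMap.map_triple_swap_right (α : V [⋀^Fin 3]→ₗ[R] N) (a b c : V) :
    α ![a, c, b] = -α ![a, b, c] := by
  rw [← α.map_swap ![a, b, c] (i := 1) (j := 2) (by decide)]
  congr 1; funext i; fin_cases i <;> rfl

variable [Algebra ℝ R] {N₁ N₂ : Type*} [AddCommGroup N₁] [Module R N₁] [AddCommGroup N₂]
  [Module R N₂] [Module ℝ N] [SMulCommClass R ℝ N] (B : N₁ →ₗ[R] N₂ →ₗ[R] N)

/-- The 120 permutations fall into 10 shuffles, each occurring `2! · 3! = 12` times, which the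
normalising factor cancels. -/
theorem pairForm_two_three (Ξ : V [⋀^Fin 2]→ₗ[R] N₁) (Ψ : V [⋀^Fin 3]→ₗ[R] N₂) (a b c d e : V) :
    pairForm B Ξ Ψ ![a, b, c, d, e] =
      B (Ξ ![a, b]) (Ψ ![c, d, e]) - B (Ξ ![a, c]) (Ψ ![b, d, e]) +
      B (Ξ ![a, d]) (Ψ ![b, c, e]) - B (Ξ ![a, e]) (Ψ ![b, c, d]) +
      B (Ξ ![b, c]) (Ψ ![a, d, e]) - B (Ξ ![b, d]) (Ψ ![a, c, e]) +
      B (Ξ ![b, e]) (Ψ ![a, c, d]) + B (Ξ ![c, d]) (Ψ ![a, b, e]) -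
      B (Ξ ![c, e]) (Ψ ![a, b, d]) + B (Ξ ![d, e]) (Ψ ![a, b, c]) := by
  have swap₂ := Ξ.map_pair_swap
  have s₁ := Ψ.map_triple_swap_left
  have s₂ := Ψ.map_triple_swap_right
  have s₃ : ∀ x y z, Ψ ![y, z, x] = Ψ ![x, y, z] := fun x y z => by
    rw [s₂, s₁, neg_neg]
  have s₄ : ∀ x y z, Ψ ![z, x, y] = Ψ ![x, y, z] := fun x y z => by
    rw [s₁, s₂, neg_neg]
  have s₅ : ∀ x y z, Ψ ![z, y, x] = -Ψ ![x, y, z] := fun x y z => by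
    rw [s₁, s₃]
  have hsum := pairForm_apply B Ξ Ψ ![a, b, c, d, e]
  have h1 : ∀ Y : Fin 5 → V, (fun i => Y (Fin.castAdd 3 i)) = ![Y 0, Y 1] := fun Y => by
    funext i; fin_cases i <;> rfl
  have h2 : ∀ Y : Fin 5 → V, (fun i => Y (Fin.natAdd 2 i)) = ![Y 2, Y 3, Y 4] := fun Y => by
    funext i; fin_cases i <;> rfl
  rw [hsum]
  change _ • altSum (fun Y : Fin 5 → V => B (Ξ fun i => Y (Fin.castAdd 3 i))
    (Ψ fun j => Y (Fin.natAdd 2 j))) ![a, b, c, d, e] = _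
  simp only [h1, h2]
  simp only [altSum_five, altSum_four, altSum_three, altSum_two, Matrix.cons_val]
  -- Only instances with arguments in alphabetical order are supplied, so every rewrite sorts the
  -- arguments and the simplification terminates.
  simp only [swap₂ a b, swap₂ a c, swap₂ a d, swap₂ a e, swap₂ b c, swap₂ b d, swap₂ b e, swap₂ c
    d, swap₂ c e, swap₂ d e,
    s₁ a b c, s₂ a b c, s₃ a b c, s₄ a b c, s₅ a b c, s₁ a b d, s₂ a b d, s₃ a b d, s₄ a b d, s₅ a
    b d, s₁ a b e, s₂ a b e, s₃ a b e, s₄ a b e, s₅ a b e, s₁ a c d, s₂ a c d, s₃ a c d, s₄ a c d,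
    s₅ a c d, s₁ a c e, s₂ a c e, s₃ a c e, s₄ a c e, s₅ a c e, s₁ a d e, s₂ a d e, s₃ a d e, s₄ a
    d e, s₅ a d e, s₁ b c d, s₂ b c d, s₃ b c d, s₄ b c d, s₅ b c d, s₁ b c e, s₂ b c e, s₃ b c e,
    s₄ b c e, s₅ b c e, s₁ b d e, s₂ b d e, s₃ b d e, s₄ b d e, s₅ b d e, s₁ c d e, s₂ c d e, s₃ c
    d e, s₄ c d e, s₅ c d e,
    map_neg, LinearMap.neg_apply, neg_neg]
  rw [inv_smul_eq_iff₀ (by positivity)]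
  norm_num [Nat.factorial]
  module

theorem pairForm_one_three (Ξ : V [⋀^Fin 1]→ₗ[R] N₁) (Ψ : V [⋀^Fin 3]→ₗ[R] N₂) (a b c d : V) :
    pairForm B Ξ Ψ ![a, b, c, d] =
      B (Ξ ![a]) (Ψ ![b, c, d]) - B (Ξ ![b]) (Ψ ![a, c, d]) + B (Ξ ![c]) (Ψ ![a, b, d]) -
      B (Ξ ![d]) (Ψ ![a, b, c]) := by
  have s₁ := Ψ.map_triple_swap_left
  have s₂ := Ψ.map_triple_swap_right
  have s₃ : ∀ x y z, Ψ ![y, z, x] = Ψ ![x, y, z] := fun x y z => by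
    rw [s₂, s₁, neg_neg]
  have s₄ : ∀ x y z, Ψ ![z, x, y] = Ψ ![x, y, z] := fun x y z => by
    rw [s₁, s₂, neg_neg]
  have s₅ : ∀ x y z, Ψ ![z, y, x] = -Ψ ![x, y, z] := fun x y z => by
    rw [s₁, s₃]
  have hsum := pairForm_apply B Ξ Ψ ![a, b, c, d]
  have h1 : ∀ Y : Fin 4 → V, (fun i => Y (Fin.castAdd 3 i)) = ![Y 0] := fun Y => by
    funext i; fin_cases i; rfl
  have h2 : ∀ Y : Fin 4 → V, (fun i => Y (Fin.natAdd 1 i)) = ![Y 1, Y 2, Y 3] := fun Y => by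
    funext i; fin_cases i <;> rfl
  rw [hsum]
  change _ • altSum (fun Y : Fin 4 → V => B (Ξ fun i => Y (Fin.castAdd 3 i))
    (Ψ fun j => Y (Fin.natAdd 1 j))) ![a, b, c, d] = _
  simp only [h1, h2]
  simp only [altSum_four, altSum_three, altSum_two, Matrix.cons_val]
  simp only [s₁ a b c, s₂ a b c, s₃ a b c, s₄ a b c, s₅ a b c, s₁ a b d, s₂ a b d, s₃ a b d, s₄ a
    b d, s₅ a b d, s₁ a c d, s₂ a c d, s₃ a c d, s₄ a c d, s₅ a c d, s₁ b c d, s₂ b c d, s₃ b c d,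
    s₄ b c d, s₅ b c d,
    map_neg]
  rw [inv_smul_eq_iff₀ (by positivity)]
  norm_num [Nat.factorial]
  module

theorem pairForm_two_two (Ξ : V [⋀^Fin 2]→ₗ[R] N₁) (Ψ : V [⋀^Fin 2]→ₗ[R] N₂) (a b c d : V) :
    pairForm B Ξ Ψ ![a, b, c, d] =
      B (Ξ ![a, b]) (Ψ ![c, d]) - B (Ξ ![a, c]) (Ψ ![b, d]) + B (Ξ ![a, d]) (Ψ ![b, c]) +
      B (Ξ ![b, c]) (Ψ ![a, d]) - B (Ξ ![b, d]) (Ψ ![a, c]) + B (Ξ ![c, d]) (Ψ ![a, b]) := by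
  have swap₂ := Ξ.map_pair_swap
  have swap₂' := Ψ.map_pair_swap
  have hsum := pairForm_apply B Ξ Ψ ![a, b, c, d]
  have h1 : ∀ Y : Fin 4 → V, (fun i => Y (Fin.castAdd 2 i)) = ![Y 0, Y 1] := fun Y => by
    funext i; fin_cases i <;> rfl
  have h2 : ∀ Y : Fin 4 → V, (fun i => Y (Fin.natAdd 2 i)) = ![Y 2, Y 3] := fun Y => by
    funext i; fin_cases i <;> rfl
  rw [hsum]
  change _ • altSum (fun Y : Fin 4 → V => B (Ξ fun i => Y (Fin.castAdd 2 i))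
    (Ψ fun j => Y (Fin.natAdd 2 j))) ![a, b, c, d] = _
  simp only [h1, h2]
  simp only [altSum_four, altSum_three, altSum_two, Matrix.cons_val]
  simp only [(swap₂ a b), (swap₂ a c), (swap₂ a d), (swap₂ b c), (swap₂ b d), (swap₂ c d),
    (swap₂' a b), (swap₂' a c), (swap₂' a d), (swap₂' b c), (swap₂' b d), (swap₂' c d),
    map_neg, LinearMap.neg_apply, neg_neg]
  rw [inv_smul_eq_iff₀ (by positivity)]
  norm_num [Nat.factorial]
  module

/-- A bilinear map as a biadditive map. -/
def LinearMap.toBiadditive (B : N₁ →ₗ[R] N₂ →ₗ[R] N) : N₁ →+ N₂ →+ N :=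
  AddMonoidHom.mk' (fun m => (B m).toAddMonoidHom) fun m m' => by ext n; simp

end PairForm

/-! ### Degree vanishing and explicit shuffle expansions of the recursive wedge product. -/

section WedgeExpansion

variable {V N N₁ N₂ : Type*} [AddCommGroup N] [AddCommGroup N₁] [AddCommGroup N₂]
  (B : N₁ →+ N₂ →+ N) {α : List V → N₁} {β : List V → N₂}

/-- Each summand of the wedge product evaluates `α` and `β` on complementary sublists of `l`, whose
lengths add up to that of `l`. -/
theorem cochainWedge_eq_zero (l : List V)
    (h : ∀ l₁ l₂ : List V, l₁.length + l₂.length = l.length → α l₁ = 0 ∨ β l₂ = 0) :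
    cochainWedge B l α β = 0 := by
  induction l generalizing α β with
  | nil => rcases h [] [] rfl with h | h <;> simp [cochainWedge, h]
  | cons X l ih =>
    rw [cochainWedge, ih, ih, add_zero]
    · intro l₁ l₂ hl
      refine (h l₁ (X :: l₂) (by simp only [List.length_cons]; omega)).imp ?_ id
      intro h0
      rw [cochainSign, h0, smul_zero]
    · intro l₁ l₂ hl
      exact h (X :: l₁) l₂ (by simp only [List.length_cons]; omega)

theorem cochainLie_eq_zero (br : V → V → V) (D : V → N →+ N) {α : List V → N} (X : V) (l : List V)
    (h : ∀ l' : List V, l'.length = l.length → α l' = 0) : cochainLie br D X l α = 0 := by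
  induction l generalizing α with
  | nil => rw [cochainLie, h [] rfl, map_zero]
  | cons Y l ih =>
    rw [cochainLie, ih (α := cochainInsert Y α) fun l' hl => h (Y :: l') (by simp [hl]), h _ (by
      simp), sub_zero]

theorem cochainD_eq_zero (br : V → V → V) (D : V → N →+ N) {α : List V → N} (l : List V)
    (h : ∀ l' : List V, l'.length + 1 = l.length → α l' = 0) : cochainD br D l α = 0 := by
  induction l generalizing α with
  | nil => rfl
  | cons X l ih =>
    rw [cochainD, ih (α := cochainInsert X α) fun l' hl => h (X :: l') (by simp [hl]),
      cochainLie_eq_zero br D X l fun l' hl => h l' (by simp [hl]), sub_zero]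

theorem cochainWedge_one_three (hα : ∀ l, l.length ≠ 1 → α l = 0)
    (hβ : ∀ l, l.length ≠ 3 → β l = 0) (a b c d : V) :
    cochainWedge B [a, b, c, d] α β =
      B (α [a]) (β [b, c, d]) - B (α [b]) (β [a, c, d]) + B (α [c]) (β [a, b, d]) -
      B (α [d]) (β [a, b, c]) := by
  simp [cochainWedge, cochainInsert, cochainSign, hα, hβ]
  abel

theorem cochainWedge_two_two (hα : ∀ l, l.length ≠ 2 → α l = 0)
    (hβ : ∀ l, l.length ≠ 2 → β l = 0) (a b c d : V) :
    cochainWedge B [a, b, c, d] α β =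
      B (α [a, b]) (β [c, d]) - B (α [a, c]) (β [b, d]) + B (α [a, d]) (β [b, c]) +
      B (α [b, c]) (β [a, d]) - B (α [b, d]) (β [a, c]) + B (α [c, d]) (β [a, b]) := by
  simp [cochainWedge, cochainInsert, cochainSign, hα, hβ]
  abel

theorem cochainWedge_two_three (hα : ∀ l, l.length ≠ 2 → α l = 0)
    (hβ : ∀ l, l.length ≠ 3 → β l = 0) (a b c d e : V) :
    cochainWedge B [a, b, c, d, e] α β =
      B (α [a, b]) (β [c, d, e]) - B (α [a, c]) (β [b, d, e]) + B (α [a, d]) (β [b, c, e]) -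
      B (α [a, e]) (β [b, c, d]) + B (α [b, c]) (β [a, d, e]) - B (α [b, d]) (β [a, c, e]) +
      B (α [b, e]) (β [a, c, d]) + B (α [c, d]) (β [a, b, e]) - B (α [c, e]) (β [a, b, d]) +
      B (α [d, e]) (β [a, b, c]) := by
  simp [cochainWedge, cochainInsert, cochainSign, hα, hβ]
  abel

theorem cochainWedge_three_two (hα : ∀ l, l.length ≠ 3 → α l = 0)
    (hβ : ∀ l, l.length ≠ 2 → β l = 0) (a b c d e : V) :
    cochainWedge B [a, b, c, d, e] α β =
      B (α [a, b, c]) (β [d, e]) - B (α [a, b, d]) (β [c, e]) + B (α [a, b, e]) (β [c, d]) +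
      B (α [a, c, d]) (β [b, e]) - B (α [a, c, e]) (β [b, d]) + B (α [a, d, e]) (β [b, c]) -
      B (α [b, c, d]) (β [a, e]) + B (α [b, c, e]) (β [a, d]) - B (α [b, d, e]) (β [a, c]) +
      B (α [c, d, e]) (β [a, b]) := by
  simp [cochainWedge, cochainInsert, cochainSign, hα, hβ]
  abel

theorem cochainWedge_one_four (hα : ∀ l, l.length ≠ 1 → α l = 0)
    (hβ : ∀ l, l.length ≠ 4 → β l = 0) (a b c d e : V) :
    cochainWedge B [a, b, c, d, e] α β =
      B (α [a]) (β [b, c, d, e]) - B (α [b]) (β [a, c, d, e]) + B (α [c]) (β [a, b, d, e]) -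
      B (α [d]) (β [a, b, c, e]) + B (α [e]) (β [a, b, c, d]) := by
  simp [cochainWedge, cochainInsert, cochainSign, hα, hβ]
  abel

theorem cochainWedge_two_four (hα : ∀ l, l.length ≠ 2 → α l = 0)
    (hβ : ∀ l, l.length ≠ 4 → β l = 0) (a b c d e f : V) :
    cochainWedge B [a, b, c, d, e, f] α β =
      B (α [a, b]) (β [c, d, e, f]) - B (α [a, c]) (β [b, d, e, f]) +
      B (α [a, d]) (β [b, c, e, f]) - B (α [a, e]) (β [b, c, d, f]) +
      B (α [a, f]) (β [b, c, d, e]) + B (α [b, c]) (β [a, d, e, f]) -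
      B (α [b, d]) (β [a, c, e, f]) + B (α [b, e]) (β [a, c, d, f]) -
      B (α [b, f]) (β [a, c, d, e]) + B (α [c, d]) (β [a, b, e, f]) -
      B (α [c, e]) (β [a, b, d, f]) + B (α [c, f]) (β [a, b, d, e]) +
      B (α [d, e]) (β [a, b, c, f]) - B (α [d, f]) (β [a, b, c, e]) +
      B (α [e, f]) (β [a, b, c, d]) := by
  simp [cochainWedge, cochainInsert, cochainSign, hα, hβ]
  abel

theorem cochainWedge_three_three (hα : ∀ l, l.length ≠ 3 → α l = 0)
    (hβ : ∀ l, l.length ≠ 3 → β l = 0) (a b c d e f : V) :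
    cochainWedge B [a, b, c, d, e, f] α β =
      B (α [a, b, c]) (β [d, e, f]) - B (α [a, b, d]) (β [c, e, f]) +
      B (α [a, b, e]) (β [c, d, f]) - B (α [a, b, f]) (β [c, d, e]) +
      B (α [a, c, d]) (β [b, e, f]) - B (α [a, c, e]) (β [b, d, f]) +
      B (α [a, c, f]) (β [b, d, e]) + B (α [a, d, e]) (β [b, c, f]) -
      B (α [a, d, f]) (β [b, c, e]) + B (α [a, e, f]) (β [b, c, d]) -
      B (α [b, c, d]) (β [a, e, f]) + B (α [b, c, e]) (β [a, d, f]) -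
      B (α [b, c, f]) (β [a, d, e]) - B (α [b, d, e]) (β [a, c, f]) +
      B (α [b, d, f]) (β [a, c, e]) - B (α [b, e, f]) (β [a, c, d]) +
      B (α [c, d, e]) (β [a, b, f]) - B (α [c, d, f]) (β [a, b, e]) +
      B (α [c, e, f]) (β [a, b, d]) - B (α [d, e, f]) (β [a, b, c]) := by
  simp [cochainWedge, cochainInsert, cochainSign, hα, hβ]
  abel

end WedgeExpansion

/-! ### The pairing of forms is the recursive wedge product. -/

section AltCochainValues

variable {R V N : Type*} [CommRing R] [AddCommGroup V] [Module R V] [AddCommGroup N] [Module R N]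

theorem altCochain_one (α : V [⋀^Fin 1]→ₗ[R] N) (a : V) : altCochain α [a] = α ![a] := by
  simpa using altCochain_ofFn α ![a]

theorem altCochain_two (α : V [⋀^Fin 2]→ₗ[R] N) (a b : V) : altCochain α [a, b] = α ![a, b] := by
  simpa using altCochain_ofFn α ![a, b]

theorem altCochain_three (α : V [⋀^Fin 3]→ₗ[R] N) (a b c : V) :
    altCochain α [a, b, c] = α ![a, b, c] := by
  simpa using altCochain_ofFn α ![a, b, c]

theorem cochain_ext (k : ℕ) {α β : List V → N} (hα : ∀ l, l.length ≠ k → α l = 0)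
    (hβ : ∀ l, l.length ≠ k → β l = 0) (h : ∀ X : Fin k → V, α (List.ofFn X) = β (List.ofFn X)) :
    α = β := by
  funext l
  by_cases hl : l.length = k
  · subst hl
    simpa using h l.get
  · rw [hα l hl, hβ l hl]

variable [Algebra ℝ R] {N₁ N₂ : Type*} [AddCommGroup N₁] [Module R N₁] [AddCommGroup N₂]
  [Module R N₂] [Module ℝ N] [SMulCommClass R ℝ N] (B : N₁ →ₗ[R] N₂ →ₗ[R] N)

theorem cochainWedge_altCochain_eq_zero {k l : ℕ} (Ξ : V [⋀^Fin k]→ₗ[R] N₁)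
    (Ψ : V [⋀^Fin l]→ₗ[R] N₂) (L : List V) (h : L.length ≠ k + l) :
    cochainWedge B.toBiadditive L (altCochain Ξ) (altCochain Ψ) = 0 := by
  apply cochainWedge_eq_zero
  intro l₁ l₂ hl
  by_cases h1 : l₁.length = k
  · exact Or.inr (altCochain_eq_zero _ (by omega))
  · exact Or.inl (altCochain_eq_zero _ h1)

/-- Both sides live in degree five and have the same shuffle expansion there. This carries the
Leibniz rule `cochainD_wedge` over to `pairForm`. -/
theorem altCochain_pairForm_two_three (Ξ : V [⋀^Fin 2]→ₗ[R] N₁) (Ψ : V [⋀^Fin 3]→ₗ[R] N₂) :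
    altCochain (pairForm B Ξ Ψ) =
      fun l => cochainWedge B.toBiadditive l (altCochain Ξ) (altCochain Ψ) := by
  refine cochain_ext 5 (fun l hl => altCochain_eq_zero _ hl)
    (fun l hl => cochainWedge_altCochain_eq_zero B Ξ Ψ l hl) fun X => ?_
  obtain ⟨a, b, c, d, e, rfl⟩ : ∃ a b c d e, X = ![a, b, c, d, e] :=
    ⟨X 0, X 1, X 2, X 3, X 4, by ext i; fin_cases i <;> rfl⟩
  rw [altCochain_ofFn, pairForm_two_three]
  simp only [List.ofFn_succ, List.ofFn_zero, Matrix.cons_val_zero, Matrix.cons_val_succ]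
  rw [cochainWedge_two_three _ (fun l hl => altCochain_eq_zero _ hl)
    (fun l hl => altCochain_eq_zero _ hl)]
  simp only [altCochain_two, altCochain_three]
  rfl

theorem altCochain_pairForm_one_three (Ξ : V [⋀^Fin 1]→ₗ[R] N₁) (Ψ : V [⋀^Fin 3]→ₗ[R] N₂) :
    altCochain (pairForm B Ξ Ψ) =
      fun l => cochainWedge B.toBiadditive l (altCochain Ξ) (altCochain Ψ) := by
  refine cochain_ext 4 (fun l hl => altCochain_eq_zero _ hl)
    (fun l hl => cochainWedge_altCochain_eq_zero B Ξ Ψ l hl) fun X => ?_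
  obtain ⟨a, b, c, d, rfl⟩ : ∃ a b c d, X = ![a, b, c, d] :=
    ⟨X 0, X 1, X 2, X 3, by ext i; fin_cases i <;> rfl⟩
  rw [altCochain_ofFn, pairForm_one_three]
  simp only [List.ofFn_succ, List.ofFn_zero, Matrix.cons_val_zero, Matrix.cons_val_succ]
  rw [cochainWedge_one_three _ (fun l hl => altCochain_eq_zero _ hl)
    (fun l hl => altCochain_eq_zero _ hl)]
  simp only [altCochain_one, altCochain_three]
  rfl

theorem altCochain_pairForm_two_two (Ξ : V [⋀^Fin 2]→ₗ[R] N₁) (Ψ : V [⋀^Fin 2]→ₗ[R] N₂) :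
    altCochain (pairForm B Ξ Ψ) =
      fun l => cochainWedge B.toBiadditive l (altCochain Ξ) (altCochain Ψ) := by
  refine cochain_ext 4 (fun l hl => altCochain_eq_zero _ hl)
    (fun l hl => cochainWedge_altCochain_eq_zero B Ξ Ψ l hl) fun X => ?_
  obtain ⟨a, b, c, d, rfl⟩ : ∃ a b c d, X = ![a, b, c, d] :=
    ⟨X 0, X 1, X 2, X 3, by ext i; fin_cases i <;> rfl⟩
  rw [altCochain_ofFn, pairForm_two_two]
  simp only [List.ofFn_succ, List.ofFn_zero, Matrix.cons_val_zero, Matrix.cons_val_succ]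
  rw [cochainWedge_two_two _ (fun l hl => altCochain_eq_zero _ hl)
    (fun l hl => altCochain_eq_zero _ hl)]
  simp only [altCochain_two]
  rfl

end AltCochainValues

/-! ### The induced connections and the Bianchi identities. -/

section Curvature

variable {E : Type*} [NormedAddCommGroup E] [NormedSpace ℝ E] [FiniteDimensional ℝ E]
  {M : Type*} [TopologicalSpace M] [ChartedSpace E M] [IsManifold 𝓘(ℝ, E) ∞ M]
  [T2Space M] [SigmaCompactSpace M]
  {F₀ : Type*} [NormedAddCommGroup F₀] [NormedSpace ℝ F₀]
  {A₀ : M → Type*} [TopologicalSpace (TotalSpace F₀ A₀)] [∀ x, TopologicalSpace (A₀ x)]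
  [FiberBundle F₀ A₀] [∀ x, AddCommGroup (A₀ x)] [∀ x, Module ℝ (A₀ x)] [VectorBundle ℝ F₀ A₀]
  [ContMDiffVectorBundle ∞ F₀ A₀ 𝓘(ℝ, E)]
  {F₁ : Type*} [NormedAddCommGroup F₁] [NormedSpace ℝ F₁]
  {A₁ : M → Type*} [TopologicalSpace (TotalSpace F₁ A₁)] [∀ x, TopologicalSpace (A₁ x)]
  [FiberBundle F₁ A₁] [∀ x, AddCommGroup (A₁ x)] [∀ x, Module ℝ (A₁ x)] [VectorBundle ℝ F₁ A₁]
  [ContMDiffVectorBundle ∞ F₁ A₁ 𝓘(ℝ, E)]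

namespace LieTwoAlgebroid.Splitting

variable {L : LieTwoAlgebroid E F₀ A₀ F₁ A₁} (s : L.Splitting)

/-- The covariant derivative on `𝒢` induced by a splitting. -/
noncomputable def covKer (X : SmoothVF E M) : L.ker →+ L.ker :=
  AddMonoidHom.mk' (L.l2Ker (s.σ X)) fun _ _ => Subtype.ext (map_add _ _ _)

/-- The covariant derivative on `A₁` induced by a splitting. -/
noncomputable def covOne (X : SmoothVF E M) : SmoothSec E F₁ A₁ →+ SmoothSec E F₁ A₁ :=
  (L.act (s.σ X)).toAddMonoidHom

theorem covOne_apply (X : SmoothVF E M) (m : SmoothSec E F₁ A₁) :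
    s.covOne X m = L.act (s.σ X) m := rfl

theorem coe_covKer (X : SmoothVF E M) (u : L.ker) :
    (s.covKer X u : SmoothSec E F₀ A₀) = L.l2 (s.σ X) u := rfl

/-- The terms in `γ` cancel here and in `Iγ_eq`, so both curvatures depend on `σ` alone. -/
theorem Rγ_eq : s.Rγ = s.curvAux := by
  rw [Rγ, R]; abel

theorem coe_Rγ (X Y : SmoothVF E M) : (s.Rγ ![X, Y] : SmoothSec E F₀ A₀) =
    s.σ (vfBracket X Y) - L.l2 (s.σ X) (s.σ Y) := by
  rw [Rγ_eq]; rfl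

theorem Iγ_eq : s.Iγ = -L.l3.compLinearMap s.σ := by
  rw [Iγ, I]; abel

theorem Iγ_apply (X Y Z : SmoothVF E M) : s.Iγ ![X, Y, Z] = -L.l3 ![s.σ X, s.σ Y, s.σ Z] := by
  rw [Iγ_eq]
  change -L.l3 (fun i => s.σ (![X, Y, Z] i)) = _
  congr 2
  funext i
  fin_cases i <;> rfl

theorem l1_covOne (X : SmoothVF E M) (m : SmoothSec E F₁ A₁) :
    s.covKer X (L.l1Ker m) = L.l1Ker (s.covOne X m) :=
  Subtype.ext (L.l1_act _ _).symm

/-- The Bianchi identity for `R_γ`. -/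
theorem cochainD_Rγ :
    (fun l => cochainD vfBracket s.covKer l (altCochain s.Rγ)) =
      altCochain (L.l1Ker.compAlternatingMap s.Iγ) := by
  refine cochain_ext 3 (fun l hl => cochainD_eq_zero _ _ l fun l' hl' =>
    altCochain_eq_zero _ (by omega)) (fun l hl => altCochain_eq_zero _ hl) fun X => ?_
  obtain ⟨a, b, c, rfl⟩ : ∃ a b c, X = ![a, b, c] :=
    ⟨X 0, X 1, X 2, by ext i; fin_cases i <;> rfl⟩
  rw [altCochain_ofFn]
  simp only [List.ofFn_succ, List.ofFn_zero, Matrix.cons_val_zero, Matrix.cons_val_succ,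
    cochainD, cochainLie, cochainInsert, altCochain_two]
  rw [LinearMap.compAlternatingMap_apply, Iγ_apply, map_neg]
  ext1
  have h1 : ((L.l1Ker (L.l3 ![s.σ a, s.σ b, s.σ c]) : L.ker) : SmoothSec E F₀ A₀) =
    L.l1 (L.l3 ![s.σ a, s.σ b, s.σ c]) := rfl
  -- The Jacobi identity for vector fields removes the terms in `σ` of double brackets, and the
  -- terms mixing `σ[·, ·]` with `σ` cancel. What survives is the failure of the Jacobi identity for
  -- `l₂`, which is `l₁ l₃`.
  have j := vfBracket_jacobi a b c
  have j' := congrArg s.σ j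
  rw [map_add] at j'
  simp only [Submodule.coe_sub, Submodule.coe_neg, h1, L.l1_l3, coe_covKer, coe_Rγ, map_sub,
    Submodule.coe_zero, j']
  rw [L.l2_swap (s.σ c) (s.σ (vfBracket a b)), L.l2_swap (s.σ c) (L.l2 _ _)]
  abel

theorem σ_bracket (X Y : SmoothVF E M) :
    s.σ (vfBracket X Y) = (s.Rγ ![X, Y] : SmoothSec E F₀ A₀) + L.l2 (s.σ X) (s.σ Y) := by
  rw [coe_Rγ, sub_add_cancel]

/-- The Bianchi identity for `I_γ`. -/
theorem cochainD_Iγ_apply (a b c d : SmoothVF E M) :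
    cochainD vfBracket s.covOne [a, b, c, d] (altCochain s.Iγ) =
      L.l3 ![(s.Rγ ![a, b] : SmoothSec E F₀ A₀), s.σ c, s.σ d] -
      L.l3 ![(s.Rγ ![a, c] : SmoothSec E F₀ A₀), s.σ b, s.σ d] +
      L.l3 ![(s.Rγ ![a, d] : SmoothSec E F₀ A₀), s.σ b, s.σ c] +
      L.l3 ![(s.Rγ ![b, c] : SmoothSec E F₀ A₀), s.σ a, s.σ d] -
      L.l3 ![(s.Rγ ![b, d] : SmoothSec E F₀ A₀), s.σ a, s.σ c] +
      L.l3 ![(s.Rγ ![c, d] : SmoothSec E F₀ A₀), s.σ a, s.σ b] := by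
  have j := L.jacobiator (s.σ a) (s.σ b) (s.σ c) (s.σ d)
  have h2 : ∀ x y z w, L.l3 ![x, y + z, w] = L.l3 ![x, y, w] + L.l3 ![x, z, w] :=
    fun x y z w => by
      rw [L.l3.map_triple_swap_left, L.l3.map_vecCons_add, L.l3.map_triple_swap_left x,
        L.l3.map_triple_swap_left x]; abel
  have h3 : ∀ x y z w, L.l3 ![x, w, y + z] = L.l3 ![x, w, y] + L.l3 ![x, w, z] :=
    fun x y z w => by
      rw [L.l3.map_triple_swap_right, h2, L.l3.map_triple_swap_right x y,
        L.l3.map_triple_swap_right x z]; abel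
  simp only [cochainD, cochainLie, cochainInsert, altCochain_three, Iγ_apply, σ_bracket,
    L.l3.map_vecCons_add, h2, h3, covOne_apply, map_neg]
  -- After `σ[X, Y] = R_γ(X, Y) + l₂(σX, σY)` is substituted, the terms in `R_γ` match the
  -- right-hand side and the rest is the jacobiator identity up to sign.
  rw [← sub_eq_zero, ← neg_eq_zero]
  refine Eq.trans ?_ j
  have m2 : ∀ x (u : L.ker) y, L.l3 ![s.σ x, (u : SmoothSec E F₀ A₀), s.σ y] =
      -L.l3 ![(u : SmoothSec E F₀ A₀), s.σ x, s.σ y] := fun x u y =>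
    L.l3.map_triple_swap_left _ _ _
  have m3 : ∀ x (u : L.ker) y, L.l3 ![s.σ x, s.σ y, (u : SmoothSec E F₀ A₀)] =
      L.l3 ![(u : SmoothSec E F₀ A₀), s.σ x, s.σ y] := fun x u y => by
    rw [L.l3.map_triple_swap_right, m2, neg_neg]
  simp only [m2, m3]
  abel

end LieTwoAlgebroid.Splitting

end Curvature

/-! ### Linearity and signs for homogeneous cochains. -/

section AltCochainLinear

variable {R V N : Type*} [CommRing R] [AddCommGroup V] [Module R V] [AddCommGroup N] [Module R N]

theorem altCochain_sub {k : ℕ} (α β : V [⋀^Fin k]→ₗ[R] N) :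
    altCochain (α - β) = altCochain α - altCochain β := by
  funext l
  by_cases h : l.length = k <;> simp [altCochain, h]

theorem cochainSign_altCochain {k : ℕ} (α : V [⋀^Fin k]→ₗ[R] N) :
    cochainSign (altCochain α) = (-1 : ℤ) ^ k • altCochain α := by
  funext l
  by_cases h : l.length = k
  · simp [cochainSign, h]
  · simp [cochainSign, altCochain_eq_zero α h]

theorem cochainSign_altCochain_two (α : V [⋀^Fin 2]→ₗ[R] N) :
    cochainSign (altCochain α) = altCochain α := by
  simp [cochainSign_altCochain]

theorem cochainSign_altCochain_one (α : V [⋀^Fin 1]→ₗ[R] N) :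
    cochainSign (altCochain α) = -altCochain α := by
  simp [cochainSign_altCochain]

end AltCochainLinear

/-! ### Exact forms are closed; equality of de Rham classes. -/

section ExactForms

variable {E : Type*} [NormedAddCommGroup E] [NormedSpace ℝ E] [FiniteDimensional ℝ E]
  {M : Type*} [TopologicalSpace M] [ChartedSpace E M] [IsManifold 𝓘(ℝ, E) ∞ M]

theorem extDer_smul {k : ℕ} (c : ℝ) (α : DiffForm E M k) (X : Fin (k + 1) → SmoothVF E M) :
    extDer (c • α) X = c • extDer α X := by
  simp only [extDer, AlternatingMap.smul_apply, vfDeriv_const_smul, smul_add, Finset.smul_sum,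
    smul_comm c]

/-- `cochainD_d` applies because the derivation of functions is flat, by `vfDeriv_bracket`. -/
theorem extDer_extDer [T2Space M] [SigmaCompactSpace M] {k : ℕ} {α : DiffForm E M (k + 1)}
    {η : DiffForm E M k} (h : ∀ X, α X = extDer η X) : α ∈ closedForms E M (k + 1) := by
  intro X
  have e : altCochain α = fun l => cochainD vfBracket vfDerivHom l (altCochain η) :=
    cochain_ext (k + 1) (fun l hl => altCochain_eq_zero _ hl)
      (fun l hl => cochainD_eq_zero _ _ l fun l' hl' => altCochain_eq_zero _ (by omega))
      fun Y => by rw [altCochain_ofFn, h, extDer_eq_cochainD]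
  rw [extDer_eq_cochainD, e]
  exact cochainD_d vfBracket_jacobi vfDeriv_bracket _ (isAdditiveCochain_altCochain η)

theorem deRhamClass_eq_of_sub_eq_extDer {k : ℕ} {α β : DiffForm E M (k + 1)}
    (hα : α ∈ closedForms E M (k + 1)) (hβ : β ∈ closedForms E M (k + 1)) {η : DiffForm E M k}
    (h : ∀ X, β X - α X = extDer η X) : deRhamClass α hα = deRhamClass β hβ := by
  refine QuotientAddGroup.eq.mpr ⟨η, fun X => ?_⟩
  rw [← h X]
  change -α X + β X = _
  abel

end ExactForms

/-! ### Closedness of `S(R_γ, I_γ)` and comparison with `S(R, I)`. -/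

section Quadratic

variable {E : Type*} [NormedAddCommGroup E] [NormedSpace ℝ E] [FiniteDimensional ℝ E]
  {M : Type*} [TopologicalSpace M] [ChartedSpace E M] [IsManifold 𝓘(ℝ, E) ∞ M]
  [T2Space M] [SigmaCompactSpace M]
  {F₀ : Type*} [NormedAddCommGroup F₀] [NormedSpace ℝ F₀]
  {A₀ : M → Type*} [TopologicalSpace (TotalSpace F₀ A₀)] [∀ x, TopologicalSpace (A₀ x)]
  [FiberBundle F₀ A₀] [∀ x, AddCommGroup (A₀ x)] [∀ x, Module ℝ (A₀ x)] [VectorBundle ℝ F₀ A₀]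
  [ContMDiffVectorBundle ∞ F₀ A₀ 𝓘(ℝ, E)]
  {F₁ : Type*} [NormedAddCommGroup F₁] [NormedSpace ℝ F₁]
  {A₁ : M → Type*} [TopologicalSpace (TotalSpace F₁ A₁)] [∀ x, TopologicalSpace (A₁ x)]
  [FiberBundle F₁ A₁] [∀ x, AddCommGroup (A₁ x)] [∀ x, Module ℝ (A₁ x)] [VectorBundle ℝ F₁ A₁]
  [ContMDiffVectorBundle ∞ F₁ A₁ 𝓘(ℝ, E)]

namespace LieTwoAlgebroid.Splitting

variable {L : LieTwoAlgebroid E F₀ A₀ F₁ A₁} (s : L.Splitting)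

theorem cochainD_γ :
    (fun l => cochainD vfBracket s.covOne l (altCochain s.γ)) = altCochain s.dγ := by
  refine cochain_ext 3 (fun l hl => cochainD_eq_zero _ _ l fun l' hl' =>
    altCochain_eq_zero _ (by omega)) (fun l hl => altCochain_eq_zero _ hl) fun X => ?_
  obtain ⟨a, b, c, rfl⟩ : ∃ a b c, X = ![a, b, c] :=
    ⟨X 0, X 1, X 2, by ext i; fin_cases i <;> rfl⟩
  rw [altCochain_ofFn]
  change _ = s.nabla1 a (s.γ ![b, c]) - s.nabla1 b (s.γ ![a, c]) + s.nabla1 c (s.γ ![a, b])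
      - s.γ ![vfBracket a b, c] + s.γ ![vfBracket a c, b] - s.γ ![vfBracket b c, a]
  simp only [List.ofFn_succ, List.ofFn_zero, Matrix.cons_val_zero, Matrix.cons_val_succ,
    cochainD, cochainLie, cochainInsert, altCochain_two]
  rw [s.γ_swap b (vfBracket a c), s.γ_swap a (vfBracket b c)]
  simp only [covOne_apply, nabla1]
  abel

/-- `l₁` intertwines the connections on `A₁` and `𝒢`, hence commutes with `d_∇`. -/
theorem cochainD_l1_γ :
    (fun l => cochainD vfBracket s.covKer l (altCochain (L.l1Ker.compAlternatingMap s.γ))) =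
      altCochain (L.l1Ker.compAlternatingMap s.dγ) := by
  refine cochain_ext 3 (fun l hl => cochainD_eq_zero _ _ l fun l' hl' =>
    altCochain_eq_zero _ (by omega)) (fun l hl => altCochain_eq_zero _ hl) fun X => ?_
  obtain ⟨a, b, c, rfl⟩ : ∃ a b c, X = ![a, b, c] :=
    ⟨X 0, X 1, X 2, by ext i; fin_cases i <;> rfl⟩
  have h := congrFun s.cochainD_γ [a, b, c]
  rw [altCochain_three] at h
  rw [altCochain_ofFn, LinearMap.compAlternatingMap_apply, ← h]
  simp only [List.ofFn_succ, List.ofFn_zero, Matrix.cons_val_zero, Matrix.cons_val_succ,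
    cochainD, cochainLie, cochainInsert, altCochain_two, LinearMap.compAlternatingMap_apply,
    map_sub, l1_covOne, map_zero]

end LieTwoAlgebroid.Splitting

namespace QuadraticLieTwoAlgebroid

variable (Q : QuadraticLieTwoAlgebroid E F₀ A₀ F₁ A₁) (s : Q.Splitting)

/-- The invariance of `S` at `a = σ(X)`, in the form that the Leibniz rule for the wedge product
requires. -/
theorem S_covariant (X : SmoothVF E M) (u : Q.ker) (m : SmoothSec E F₁ A₁) :
    vfDerivHom X (Q.S.toBiadditive u m) =
      Q.S.toBiadditive (s.covKer X u) m + Q.S.toBiadditive u (s.covOne X m) := by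
  have h := Q.S_l2 (s.σ X) u m
  rw [s.ρ_σ] at h
  exact h

theorem S_l3_left (a b : SmoothSec E F₀ A₀) (u v : Q.ker) :
    Q.S.toBiadditive v (Q.l3 ![(u : SmoothSec E F₀ A₀), a, b]) =
      -Q.S.toBiadditive u (Q.l3 ![(v : SmoothSec E F₀ A₀), a, b]) := by
  have h : ∀ c, Q.l3 ![c, a, b] = Q.l3 ![a, b, c] := fun c => by
    rw [Q.l3.map_triple_swap_left, Q.l3.map_triple_swap_right, neg_neg]
  rw [h, h]
  exact Q.S_l3 a b u v

/-- `S(l₁ m, p)` is symmetric in `m` and `p`, and a form of even degree commutes past the other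
without a sign. -/
theorem cochainWedge_l1_comm {Ξ : SmoothVF E M [⋀^Fin 2]→ₗ[SmoothFun E M] SmoothSec E F₁ A₁}
    {Ψ : SmoothVF E M [⋀^Fin 3]→ₗ[SmoothFun E M] SmoothSec E F₁ A₁} (X : Fin 5 → SmoothVF E M) :
    cochainWedge Q.S.toBiadditive (List.ofFn X) (altCochain (Q.l1Ker.compAlternatingMap Ψ))
      (altCochain Ξ) = cochainWedge Q.S.toBiadditive (List.ofFn X)
        (altCochain (Q.l1Ker.compAlternatingMap Ξ)) (altCochain Ψ) := by
  obtain ⟨a, b, c, d, e, rfl⟩ : ∃ a b c d e, X = ![a, b, c, d, e] :=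
    ⟨X 0, X 1, X 2, X 3, X 4, by ext i; fin_cases i <;> rfl⟩
  simp only [List.ofFn_succ, List.ofFn_zero, Matrix.cons_val_zero, Matrix.cons_val_succ]
  rw [cochainWedge_three_two _ (fun l hl => altCochain_eq_zero _ hl)
    (fun l hl => altCochain_eq_zero _ hl), cochainWedge_two_three _
    (fun l hl => altCochain_eq_zero _ hl) (fun l hl => altCochain_eq_zero _ hl)]
  have h : ∀ a b c d e, Q.S.toBiadditive (Q.l1Ker (Ψ ![a, b, c])) (Ξ ![d, e]) =
    Q.S.toBiadditive (Q.l1Ker (Ξ ![d, e])) (Ψ ![a, b, c]) := fun a b c d e => Q.S_l1 _ _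
  simp only [altCochain_two, altCochain_three, LinearMap.compAlternatingMap_apply]
  linear_combination h a b c d e - h a b d c e + h a b e c d + h a c d b e - h a c e b d + h a d e
    b c -
    h b c d a e + h b c e a d - h b d e a c + h c d e a b

/-- Exchanging the two blocks of a (3,3)-shuffle is odd, while `S(l₁ m, p)` is symmetric; the 20
shuffles cancel in 10 complementary pairs. -/
theorem cochainWedge_l1_self (Ψ : SmoothVF E M [⋀^Fin 3]→ₗ[SmoothFun E M] SmoothSec E F₁ A₁)
    (X : Fin 6 → SmoothVF E M) :
    cochainWedge Q.S.toBiadditive (List.ofFn X) (altCochain (Q.l1Ker.compAlternatingMap Ψ))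
      (altCochain Ψ) = 0 := by
  obtain ⟨a, b, c, d, e, f, rfl⟩ : ∃ a b c d e f, X = ![a, b, c, d, e, f] :=
    ⟨X 0, X 1, X 2, X 3, X 4, X 5, by ext i; fin_cases i <;> rfl⟩
  simp only [List.ofFn_succ, List.ofFn_zero, Matrix.cons_val_zero, Matrix.cons_val_succ]
  have h : ∀ a b c d e f, Q.S.toBiadditive (Q.l1Ker (Ψ ![a, b, c])) (Ψ ![d, e, f]) =
      Q.S.toBiadditive (Q.l1Ker (Ψ ![d, e, f])) (Ψ ![a, b, c]) :=
    fun a b c d e f => Q.S_l1 _ _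
  rw [cochainWedge_three_three _ (fun l hl => altCochain_eq_zero _ hl)
    (fun l hl => altCochain_eq_zero _ hl)]
  simp only [altCochain_three, LinearMap.compAlternatingMap_apply]
  linear_combination h a b c d e f - h a b d c e f + h a b e c d f - h a b f c d e + h a c d b e f -
    h a c e b d f + h a c f b d e + h a d e b c f - h a d f b c e + h a e f b c d

-- Expanding `d_∇ I_γ` gives 90 terms `S(R_γ, l₃(R_γ, σ, σ))`. Exchanging the two pairs of arguments
-- fed to `R_γ` preserves the sign of the permutation but reverses the pairing, so the terms cancel
-- in 45 pairs.
set_option maxHeartbeats 800000 in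
theorem cochainWedge_Rγ_d_Iγ (X : Fin 6 → SmoothVF E M) :
    cochainWedge Q.S.toBiadditive (List.ofFn X) (altCochain s.Rγ)
      (fun l => cochainD vfBracket s.covOne l (altCochain s.Iγ)) = 0 := by
  obtain ⟨a, b, c, d, e, f, rfl⟩ : ∃ a b c d e f, X = ![a, b, c, d, e, f] :=
    ⟨X 0, X 1, X 2, X 3, X 4, X 5, by ext i; fin_cases i <;> rfl⟩
  simp only [List.ofFn_succ, List.ofFn_zero, Matrix.cons_val_zero, Matrix.cons_val_succ]
  have h : ∀ a b c d e f, Q.S.toBiadditive (s.Rγ ![a, b])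
      (Q.l3 ![(s.Rγ ![c, d] : SmoothSec E F₀ A₀), s.σ e, s.σ f]) =
      -Q.S.toBiadditive (s.Rγ ![c, d])
      (Q.l3 ![(s.Rγ ![a, b] : SmoothSec E F₀ A₀), s.σ e, s.σ f]) :=
    fun a b c d e f => Q.S_l3_left _ _ _ _
  rw [cochainWedge_two_four _ (fun l hl => altCochain_eq_zero _ hl)
    (fun l hl => cochainD_eq_zero _ _ l fun l' hl' => altCochain_eq_zero _ (by omega))]
  simp only [altCochain_two, s.cochainD_Iγ_apply, map_add, map_sub]
  linear_combination h a b c d e f - h a b c e d f + h a b c f d e + h a b d e c f - h a b d f c e +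
    h a b e f c d - h a c b d e f + h a c b e d f - h a c b f d e - h a c d e b f +
    h a c d f b e - h a c e f b d + h a d b c e f - h a d b e c f + h a d b f c e +
    h a d c e b f - h a d c f b e + h a d e f b c - h a e b c d f + h a e b d c f -
    h a e b f c d - h a e c d b f + h a e c f b d - h a e d f b c + h a f b c d e -
    h a f b d c e + h a f b e c d + h a f c d b e - h a f c e b d + h a f d e b c +
    h b c d e a f - h b c d f a e + h b c e f a d - h b d c e a f + h b d c f a e -
    h b d e f a c + h b e c d a f - h b e c f a d + h b e d f a c - h b f c d a e +
    h b f c e a d - h b f d e a c + h c d e f a b - h c e d f a b + h c f d e a b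

theorem formRγIγ_mem_closedForms : Q.formRγIγ s ∈ closedForms E M 5 := by
  intro X
  rw [extDer_eq_cochainD, formRγIγ, altCochain_pairForm_two_three,
    cochainD_wedge _ _ (Q.S_covariant s), s.cochainD_Rγ, cochainSign_altCochain_two,
    Q.cochainWedge_l1_self, Q.cochainWedge_Rγ_d_Iγ, add_zero]

theorem formRI_sub_formRγIγ : ∃ η : DiffForm E M 4, ∀ X,
    Q.formRI s X - Q.formRγIγ s X = extDer η X := by
  -- `d S(R_γ, γ)` yields the two terms of the difference linear in `γ`, up to sign; `d S(l₁ γ, γ) =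
  -- 2 S(l₁ γ, d_∇ γ)` is twice the quadratic one, whence the factor one half.
  refine ⟨(2⁻¹ : ℝ) • pairForm Q.S (Q.l1Ker.compAlternatingMap s.γ) s.γ - pairForm Q.S s.Rγ s.γ,
    fun X => ?_⟩
  have hR : altCochain s.R = altCochain s.Rγ - altCochain (Q.l1Ker.compAlternatingMap s.γ) := by
    rw [← altCochain_sub]; rw [LieTwoAlgebroid.Splitting.Rγ]; congr 1; abel
  have hI : altCochain s.I = altCochain s.Iγ - altCochain s.dγ := by
    rw [← altCochain_sub]; rw [LieTwoAlgebroid.Splitting.Iγ]; congr 1; abel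
  rw [sub_eq_add_neg _ (pairForm Q.S s.Rγ s.γ), extDer_add, extDer_neg, extDer_smul,
    ← altCochain_ofFn (Q.formRI s), ← altCochain_ofFn (Q.formRγIγ s), extDer_eq_cochainD,
    extDer_eq_cochainD, formRI, formRγIγ, altCochain_pairForm_two_three,
    altCochain_pairForm_two_three, altCochain_pairForm_two_two, altCochain_pairForm_two_two,
    cochainD_wedge _ _ (Q.S_covariant s), cochainD_wedge _ _ (Q.S_covariant s),
    cochainSign_altCochain_two, cochainSign_altCochain_two, s.cochainD_Rγ, s.cochainD_γ,
    s.cochainD_l1_γ, Q.cochainWedge_l1_comm, Q.cochainWedge_l1_comm, ← two_smul ℝ, smul_smul]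
  simp only [hR, hI, cochainWedge_sub_left, cochainWedge_sub_right]
  norm_num
  abel

end QuadraticLieTwoAlgebroid

end Quadratic

/-! ### Simpson's rule, exact for cubic polynomials. -/

section SimpsonRule

/-- The expansion of `F` about every point has linear coefficient `-g`, so `F' = -g`, and Simpson's
rule integrates the cubic `g` over `[0, 1]` without error. -/
theorem simpson_of_taylor {F g : ℝ → ℝ} {g₀ g₁ g₂ g₃ : ℝ}
    (hg : ∀ t, g t = g₀ + t * g₁ + t ^ 2 * g₂ + t ^ 3 * g₃)
    (hF : ∀ t, ∃ c₂ c₃ c₄ c₅ : ℝ, ∀ u,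
      F (t + u) = F t - u * g t + u ^ 2 * (c₂ + u * c₃ + u ^ 2 * c₄ + u ^ 3 * c₅)) :
    F 1 - F 0 = -(6⁻¹ * (g 0 + 4 * g 2⁻¹ + g 1)) := by
  have hd : ∀ t, HasDerivAt F (-g t) t := by
    intro t
    obtain ⟨c₂, c₃, c₄, c₅, h⟩ := hF t
    have e : F = fun v => F t - (v - t) * g t +
        (v - t) ^ 2 * (c₂ + (v - t) * c₃ + (v - t) ^ 2 * c₄ + (v - t) ^ 3 * c₅) := by
      funext v
      rw [← h, add_sub_cancel]
    have h1 : HasDerivAt (fun v : ℝ => v - t) 1 t := (hasDerivAt_id t).sub_const t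
    have h2 : DifferentiableAt ℝ
        (fun v => c₂ + (v - t) * c₃ + (v - t) ^ 2 * c₄ + (v - t) ^ 3 * c₅) t := by fun_prop
    rw [e]
    have h3 := ((h1.mul_const (g t)).const_sub (F t)).add ((h1.pow 2).mul h2.hasDerivAt)
    refine h3.congr_deriv ?_
    simp
  -- `F` plus the explicit antiderivative of `g` is constant.
  have hc : ∀ t, HasDerivAt
      (fun t => F t + (t * g₀ + t ^ 2 * (g₁ / 2) + t ^ 3 * (g₂ / 3) + t ^ 4 * (g₃ / 4))) 0 t := by
    intro t
    have h := (hd t).add (((((hasDerivAt_id t).mul_const g₀).add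
      ((hasDerivAt_pow 2 t).mul_const (g₁ / 2))).add
      ((hasDerivAt_pow 3 t).mul_const (g₂ / 3))).add ((hasDerivAt_pow 4 t).mul_const (g₃ / 4)))
    refine h.congr_deriv ?_
    rw [hg]
    norm_num
    ring
  have h := is_const_of_deriv_eq_zero (fun t => (hc t).differentiableAt) (fun t => (hc t).deriv) 1 0
  simp only [hg]
  norm_num at h ⊢
  linarith

end SimpsonRule

/-! ### Scalars, and cochains given by binary or ternary operations. -/

section CochainSMul

variable {V N N₁ N₂ : Type*} [AddCommGroup N] [AddCommGroup N₁] [AddCommGroup N₂]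
  {K : Type*} [Monoid K] [DistribMulAction K N] [DistribMulAction K N₁] [DistribMulAction K N₂]

theorem cochainSign_smul (c : K) (α : List V → N) :
    cochainSign (c • α) = c • cochainSign α := by
  funext l
  exact smul_comm _ c (α l)

theorem cochainWedge_smul_left {B : N₁ →+ N₂ →+ N} {c : K}
    (hB : ∀ m n, B (c • m) n = c • B m n) (l : List V) (α : List V → N₁) (β : List V → N₂) :
    cochainWedge B l (c • α) β = c • cochainWedge B l α β := by
  induction l generalizing α β with
  | nil => exact hB _ _
  | cons X l ih =>
    have h : cochainInsert X (c • α) = c • cochainInsert X α := rfl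
    simp only [cochainWedge, h, cochainSign_smul, ih, smul_add]

theorem cochainWedge_smul_right {B : N₁ →+ N₂ →+ N} {c : K}
    (hB : ∀ m n, B m (c • n) = c • B m n) (l : List V) (α : List V → N₁) (β : List V → N₂) :
    cochainWedge B l α (c • β) = c • cochainWedge B l α β := by
  induction l generalizing α β with
  | nil => exact hB _ _
  | cons X l ih =>
    have h : cochainInsert X (c • β) = c • cochainInsert X β := rfl
    simp only [cochainWedge, h, ih, smul_add]

theorem cochainLie_smul {br : V → V → V} {D : V → N →+ N} {c : K}
    (hD : ∀ X n, D X (c • n) = c • D X n) (X : V) (l : List V) (α : List V → N) :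
    cochainLie br D X l (c • α) = c • cochainLie br D X l α := by
  induction l generalizing α with
  | nil => exact hD _ _
  | cons Y l ih =>
    have h : cochainInsert Y (c • α) = c • cochainInsert Y α := rfl
    simp only [cochainLie, h, ih, smul_sub, Pi.smul_apply]

theorem cochainD_smul {br : V → V → V} {D : V → N →+ N} {c : K}
    (hD : ∀ X n, D X (c • n) = c • D X n) (l : List V) (α : List V → N) :
    cochainD br D l (c • α) = c • cochainD br D l α := by
  induction l generalizing α with
  | nil => exact (smul_zero c).symm
  | cons Y l ih =>
    have h : cochainInsert Y (c • α) = c • cochainInsert Y α := rfl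
    simp only [cochainD, h, ih, smul_sub, cochainLie_smul hD]

/-- A binary operation as a cochain of degree two. -/
def cochainOfTwo (f : V → V → N) : List V → N
  | [a, b] => f a b
  | _ => 0

/-- A ternary operation as a cochain of degree three. -/
def cochainOfThree (f : V → V → V → N) : List V → N
  | [a, b, c] => f a b c
  | _ => 0

theorem cochainOfTwo_eq_zero (f : V → V → N) (l : List V) (h : l.length ≠ 2) :
    cochainOfTwo f l = 0 := by
  rcases l with _ | ⟨a, _ | ⟨b, _ | ⟨c, l⟩⟩⟩ <;> first | rfl | exact absurd rfl h

theorem cochainOfThree_eq_zero (f : V → V → V → N) (l : List V) (h : l.length ≠ 3) :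
    cochainOfThree f l = 0 := by
  rcases l with _ | ⟨a, _ | ⟨b, _ | ⟨c, _ | ⟨d, l⟩⟩⟩⟩ <;> first | rfl | exact absurd rfl h

end CochainSMul

/-! ### Variation of `σ` and the transgression form. -/

section Transgression

variable {E : Type*} [NormedAddCommGroup E] [NormedSpace ℝ E] [FiniteDimensional ℝ E]
  {M : Type*} [TopologicalSpace M] [ChartedSpace E M] [IsManifold 𝓘(ℝ, E) ∞ M]
  [T2Space M] [SigmaCompactSpace M]
  {F₀ : Type*} [NormedAddCommGroup F₀] [NormedSpace ℝ F₀]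
  {A₀ : M → Type*} [TopologicalSpace (TotalSpace F₀ A₀)] [∀ x, TopologicalSpace (A₀ x)]
  [FiberBundle F₀ A₀] [∀ x, AddCommGroup (A₀ x)] [∀ x, Module ℝ (A₀ x)] [VectorBundle ℝ F₀ A₀]
  [ContMDiffVectorBundle ∞ F₀ A₀ 𝓘(ℝ, E)]
  {F₁ : Type*} [NormedAddCommGroup F₁] [NormedSpace ℝ F₁]
  {A₁ : M → Type*} [TopologicalSpace (TotalSpace F₁ A₁)] [∀ x, TopologicalSpace (A₁ x)]
  [FiberBundle F₁ A₁] [∀ x, AddCommGroup (A₁ x)] [∀ x, Module ℝ (A₁ x)] [VectorBundle ℝ F₁ A₁]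
  [ContMDiffVectorBundle ∞ F₁ A₁ 𝓘(ℝ, E)]

namespace LieTwoAlgebroid.Splitting

variable {L : LieTwoAlgebroid E F₀ A₀ F₁ A₁} (s : L.Splitting)

/-- The splitting `(σ + B, γ)`, for a `𝒢`-valued one-form `B`. -/
noncomputable def shift (B : SmoothVF E M →ₗ[SmoothFun E M] L.ker) : L.Splitting where
  σ := s.σ + L.ker.subtype ∘ₗ B
  ρ_σ X := by
    rw [LinearMap.add_apply, map_add, s.ρ_σ, LinearMap.comp_apply, Submodule.subtype_apply,
      LinearMap.mem_ker.mp (B X).2, add_zero]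
  γ := s.γ

variable (B : SmoothVF E M →ₗ[SmoothFun E M] L.ker)

theorem shift_smul_σ (t : ℝ) (X : SmoothVF E M) :
    (s.shift (t • B)).σ X = s.σ X + t • (B X : SmoothSec E F₀ A₀) := rfl

theorem shift_shift (B' : SmoothVF E M →ₗ[SmoothFun E M] L.ker) :
    (s.shift B).shift B' = s.shift (B + B') := by
  simp only [shift, LinearMap.comp_add, add_assoc]

/-- A linear map as a form of degree one. -/
noncomputable abbrev oneForm {R V N : Type*} [CommRing R] [AddCommGroup V] [Module R V]
    [AddCommGroup N] [Module R N] (B : V →ₗ[R] N) : V [⋀^Fin 1]→ₗ[R] N :=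
  AlternatingMap.ofSubsingleton R V N (0 : Fin 1) B

/-- Expand `l₂(σ + tB, σ + tB)`: the terms linear in `t`, together with `B[X, Y]`, form `-d_∇ B`. -/
theorem altCochain_Rγ_shift (t : ℝ) : altCochain (s.shift (t • B)).Rγ =
    altCochain s.Rγ - t • (fun l => cochainD vfBracket s.covKer l (altCochain (oneForm B))) -
      t ^ 2 • cochainOfTwo fun X Y => L.l2Ker (B X) (B Y) := by
  refine cochain_ext 2 (fun l hl => altCochain_eq_zero _ hl) (fun l hl => ?_) fun X => ?_
  · simp only [Pi.sub_apply, Pi.smul_apply, altCochain_eq_zero _ hl, cochainOfTwo_eq_zero _ l hl]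
    rw [cochainD_eq_zero _ _ l fun l' hl' => altCochain_eq_zero _ (by omega)]
    simp
  · obtain ⟨a, b, rfl⟩ : ∃ a b, X = ![a, b] := ⟨X 0, X 1, by ext i; fin_cases i <;> rfl⟩
    simp only [List.ofFn_succ, List.ofFn_zero, Matrix.cons_val_zero, Matrix.cons_val_succ,
      Pi.sub_apply, Pi.smul_apply, cochainD, cochainLie, cochainInsert, altCochain_two,
      altCochain_one, cochainOfTwo]
    ext1
    have h1 : ∀ u v : L.ker, ((L.l2Ker u v : L.ker) : SmoothSec E F₀ A₀) = L.l2 u v :=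
      fun u v => rfl
    have h2 : ∀ X, (oneForm B) ![X] = B X := fun X => rfl
    have h3 : ∀ (t : ℝ) (u : L.ker), ((t • u : L.ker) : SmoothSec E F₀ A₀) =
        t • (u : SmoothSec E F₀ A₀) :=
      fun t u => rfl
    simp only [Submodule.coe_sub, h1, h2, h3, coe_Rγ, coe_covKer, shift_smul_σ, map_add, map_smul,
      LinearMap.add_apply, LinearMap.smul_apply, Submodule.coe_zero]
    rw [L.l2_swap (B a) (s.σ b)]
    module

theorem altCochain_Iγ_shift (t : ℝ) : altCochain (s.shift (t • B)).Iγ =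
    altCochain s.Iγ -
    t • (cochainOfThree fun X Y Z => L.l3 ![(B X : SmoothSec E F₀ A₀), s.σ Y, s.σ Z] -
      L.l3 ![(B Y : SmoothSec E F₀ A₀), s.σ X, s.σ Z] +
      L.l3 ![(B Z : SmoothSec E F₀ A₀), s.σ X, s.σ Y]) -
    t ^ 2 • (cochainOfThree fun X Y Z =>
      L.l3 ![(B X : SmoothSec E F₀ A₀), (B Y : SmoothSec E F₀ A₀), s.σ Z] +
      L.l3 ![(B X : SmoothSec E F₀ A₀), s.σ Y, (B Z : SmoothSec E F₀ A₀)] +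
      L.l3 ![s.σ X, (B Y : SmoothSec E F₀ A₀), (B Z : SmoothSec E F₀ A₀)]) -
    t ^ 3 • (cochainOfThree fun X Y Z => L.l3 ![(B X : SmoothSec E F₀ A₀),
      (B Y : SmoothSec E F₀ A₀), (B Z : SmoothSec E F₀ A₀)]) := by
  refine cochain_ext 3 (fun l hl => altCochain_eq_zero _ hl) (fun l hl => ?_) fun X => ?_
  · simp only [Pi.sub_apply, Pi.smul_apply, altCochain_eq_zero _ hl, cochainOfThree_eq_zero _ l hl]
    simp
  · obtain ⟨a, b, c, rfl⟩ : ∃ a b c, X = ![a, b, c] :=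
      ⟨X 0, X 1, X 2, by ext i; fin_cases i <;> rfl⟩
    simp only [List.ofFn_succ, List.ofFn_zero, Matrix.cons_val_zero, Matrix.cons_val_succ,
      Pi.sub_apply, Pi.smul_apply, altCochain_three, cochainOfThree, Iγ_apply, shift_smul_σ]
    have h1 : ∀ x y z w, L.l3 ![x + t • y, z, w] = L.l3 ![x, z, w] + t • L.l3 ![y, z, w] :=
      fun x y z w => by
        rw [L.l3.map_vecCons_add, ← algebraMap_smul (SmoothFun E M) t y, L.l3.map_vecCons_smul,
          algebraMap_smul]
    have h2 : ∀ x y z w, L.l3 ![z, x + t • y, w] = L.l3 ![z, x, w] + t • L.l3 ![z, y, w] :=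
      fun x y z w => by
        rw [L.l3.map_triple_swap_left, h1, L.l3.map_triple_swap_left z,
          L.l3.map_triple_swap_left z]; module
    have h3 : ∀ x y z w, L.l3 ![z, w, x + t • y] = L.l3 ![z, w, x] + t • L.l3 ![z, w, y] :=
      fun x y z w => by
        rw [L.l3.map_triple_swap_right, h2, L.l3.map_triple_swap_right z w x,
          L.l3.map_triple_swap_right z w y]; module
    rw [h1, h2, h2, h3, h3, h3, h3, L.l3.map_triple_swap_left (s.σ a) (B b),
      L.l3.map_triple_swap_right (s.σ a) (B c) (s.σ b),
      L.l3.map_triple_swap_left (B c : SmoothSec E F₀ A₀) (s.σ a) (s.σ b)]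
    module

end LieTwoAlgebroid.Splitting

namespace QuadraticLieTwoAlgebroid

variable (Q : QuadraticLieTwoAlgebroid E F₀ A₀ F₁ A₁) (s : Q.Splitting)
  (B : SmoothVF E M →ₗ[SmoothFun E M] Q.ker)

open LieTwoAlgebroid.Splitting

theorem S_real_smul_left (t : ℝ) (u : Q.ker) (m : SmoothSec E F₁ A₁) :
    Q.S.toBiadditive (t • u) m = t • Q.S.toBiadditive u m := by
  rw [← algebraMap_smul (SmoothFun E M) t u, ← algebraMap_smul (SmoothFun E M) t
    (Q.S.toBiadditive u m)]
  change Q.S _ _ = _ • Q.S _ _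
  rw [map_smul, LinearMap.smul_apply]

theorem S_real_smul_right (t : ℝ) (u : Q.ker) (m : SmoothSec E F₁ A₁) :
    Q.S.toBiadditive u (t • m) = t • Q.S.toBiadditive u m := by
  rw [← algebraMap_smul (SmoothFun E M) t m, ← algebraMap_smul (SmoothFun E M) t
    (Q.S.toBiadditive u m)]
  exact map_smul (Q.S u) _ _

/-- The transgression form of a variation `B` of the splitting. -/
noncomputable def transgression : DiffForm E M 4 :=
  pairForm Q.S (oneForm B) s.Iγ

/-- The Leibniz rule gives `S(d_∇ B, I_γ) - S(B, d_∇ I_γ)`. In the second term the skew-symmetry of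
`S(u, l₃(v, a, b))` exchanges `B` with `R_γ`. The right-hand side is then minus the first-order
variation of `S(R_γ, I_γ)` along `B`. -/
theorem extDer_transgression (X : Fin 5 → SmoothVF E M) :
    extDer (Q.transgression s B) X =
      cochainWedge Q.S.toBiadditive (List.ofFn X)
        (fun l => cochainD vfBracket s.covKer l (altCochain (oneForm B))) (altCochain s.Iγ) +
      cochainWedge Q.S.toBiadditive (List.ofFn X) (altCochain s.Rγ)
        (cochainOfThree fun X Y Z => Q.l3 ![(B X : SmoothSec E F₀ A₀), s.σ Y, s.σ Z] -
          Q.l3 ![(B Y : SmoothSec E F₀ A₀), s.σ X, s.σ Z] +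
          Q.l3 ![(B Z : SmoothSec E F₀ A₀), s.σ X, s.σ Y]) := by
  rw [extDer_eq_cochainD, transgression, altCochain_pairForm_one_three,
    cochainD_wedge _ _ (Q.S_covariant s), cochainSign_altCochain_one, cochainWedge_neg_left]
  congr 1
  obtain ⟨a, b, c, d, e, rfl⟩ : ∃ a b c d e, X = ![a, b, c, d, e] :=
    ⟨X 0, X 1, X 2, X 3, X 4, by ext i; fin_cases i <;> rfl⟩
  simp only [List.ofFn_succ, List.ofFn_zero, Matrix.cons_val_zero, Matrix.cons_val_succ]
  rw [cochainWedge_one_four _ (fun l hl => altCochain_eq_zero _ hl)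
      (fun l hl => cochainD_eq_zero _ _ l fun l' hl' => altCochain_eq_zero _ (by omega)),
    cochainWedge_two_three _ (fun l hl => altCochain_eq_zero _ hl) (cochainOfThree_eq_zero _)]
  have h1 : ∀ X, (oneForm B) ![X] = B X := fun X => rfl
  have h : ∀ a b c d e, Q.S.toBiadditive (B a)
      (Q.l3 ![(s.Rγ ![b, c] : SmoothSec E F₀ A₀), s.σ d, s.σ e]) =
      -Q.S.toBiadditive (s.Rγ ![b, c])
      (Q.l3 ![(B a : SmoothSec E F₀ A₀), s.σ d, s.σ e]) :=
    fun a b c d e => Q.S_l3_left _ _ _ _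
  simp only [altCochain_one, altCochain_two, s.cochainD_Iγ_apply, cochainOfThree, map_add, map_sub,
    h1]
  linear_combination -h a b c d e + h a b d c e - h a b e c d - h a c d b e + h a c e b d - h a d
    e b c +
    h b a c d e - h b a d c e + h b a e c d + h b c d a e - h b c e a d + h b d e a c -
    h c a b d e + h c a d b e - h c a e b d - h c b d a e + h c b e a d - h c d e a b +
    h d a b c e - h d a c b e + h d a e b c + h d b c a e - h d b e a c + h d c e a b -
    h e a b c d + h e a c b d - h e a d b c - h e b c a d + h e b d a c - h e c d a b

theorem extDer_transgression_shift (X : Fin 5 → SmoothVF E M) :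
    ∃ g₀ g₁ g₂ g₃ : SmoothFun E M, ∀ t : ℝ, extDer (Q.transgression (s.shift (t • B)) B) X =
      g₀ + t • g₁ + t ^ 2 • g₂ + t ^ 3 • g₃ := by
  have hD : ∀ (c : ℝ) (X : SmoothVF E M) n, vfDerivHom X (c • n) = c • vfDerivHom X n :=
    fun c X n => vfDeriv_const_smul X c n
  -- The exterior derivative of scalar forms does not involve the splitting, so `t` enters only
  -- through `I_γ`, which is cubic in `t`.
  let D (β : List (SmoothVF E M) → SmoothSec E F₁ A₁) : SmoothFun E M :=
    cochainD vfBracket vfDerivHom (List.ofFn X)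
      fun l => cochainWedge Q.S.toBiadditive l (altCochain (oneForm B)) β
  have hsub : ∀ β β', D (β - β') = D β - D β' := fun β β' => by
    simp only [D, cochainWedge_sub_right]
    exact cochainD_sub _ _ _ _ _
  have hsmul : ∀ (c : ℝ) β, D (c • β) = c • D β := fun c β => by
    simp only [D, cochainWedge_smul_right (Q.S_real_smul_right c)]
    exact cochainD_smul (hD c) _ _
  have h : ∀ t : ℝ, extDer (Q.transgression (s.shift (t • B)) B) X =
      D (altCochain (s.shift (t • B)).Iγ) := fun t => by
    rw [extDer_eq_cochainD, transgression, altCochain_pairForm_one_three]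
  simp only [h, altCochain_Iγ_shift, hsub, hsmul]
  have hg : ∀ d₀ d₁ d₂ d₃ : SmoothFun E M, ∃ g₀ g₁ g₂ g₃ : SmoothFun E M, ∀ t : ℝ,
      d₀ - t • d₁ - t ^ 2 • d₂ - t ^ 3 • d₃ = g₀ + t • g₁ + t ^ 2 • g₂ + t ^ 3 • g₃ :=
    fun d₀ d₁ d₂ d₃ => ⟨d₀, -d₁, -d₂, -d₃, fun t => by module⟩
  exact hg _ _ _ _

/-- `R_γ` is quadratic and `I_γ` cubic in `t`, so the form has degree five; `extDer_transgression`
identifies its linear coefficient. -/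
theorem formRγIγ_shift (X : Fin 5 → SmoothVF E M) :
    ∃ c₂ c₃ c₄ c₅ : SmoothFun E M, ∀ t : ℝ, Q.formRγIγ (s.shift (t • B)) X =
      Q.formRγIγ s X - t • extDer (Q.transgression s B) X +
        t ^ 2 • (c₂ + t • c₃ + t ^ 2 • c₄ + t ^ 3 • c₅) := by
  let W (α : List (SmoothVF E M) → Q.ker) (β : List (SmoothVF E M) → SmoothSec E F₁ A₁) :
    SmoothFun E M := cochainWedge Q.S.toBiadditive (List.ofFn X) α β
  have h : ∀ s : Q.Splitting, Q.formRγIγ s X = W (altCochain s.Rγ) (altCochain s.Iγ) := fun s => by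
    rw [← altCochain_ofFn (Q.formRγIγ s), formRγIγ, altCochain_pairForm_two_three]
  have hl : ∀ α α' β, W (α - α') β = W α β - W α' β := cochainWedge_sub_left _ _
  have hr : ∀ α β β', W α (β - β') = W α β - W α β' := cochainWedge_sub_right _ _
  have hl' : ∀ (c : ℝ) α β, W (c • α) β = c • W α β := fun c =>
    cochainWedge_smul_left (Q.S_real_smul_left c) _
  have hr' : ∀ (c : ℝ) α β, W α (c • β) = c • W α β := fun c =>
    cochainWedge_smul_right (Q.S_real_smul_right c) _
  rw [extDer_transgression]
  simp only [h, altCochain_Rγ_shift, altCochain_Iγ_shift]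
  -- With the coefficients made opaque, the claim is a polynomial identity in `t` for the bilinear
  -- `W`.
  generalize altCochain s.Rγ = r₀
  generalize (fun l => cochainD vfBracket s.covKer l (altCochain (oneForm B))) = r₁
  generalize (cochainOfTwo fun X Y => Q.l2Ker (B X) (B Y)) = r₂
  generalize altCochain s.Iγ = i₀
  generalize (cochainOfThree fun X Y Z => Q.l3 ![(B X : SmoothSec E F₀ A₀), s.σ Y, s.σ Z] -
      Q.l3 ![(B Y : SmoothSec E F₀ A₀), s.σ X, s.σ Z] +
      Q.l3 ![(B Z : SmoothSec E F₀ A₀), s.σ X, s.σ Y]) = i₁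
  generalize (cochainOfThree fun X Y Z =>
      Q.l3 ![(B X : SmoothSec E F₀ A₀), (B Y : SmoothSec E F₀ A₀), s.σ Z] +
      Q.l3 ![(B X : SmoothSec E F₀ A₀), s.σ Y, (B Z : SmoothSec E F₀ A₀)] +
      Q.l3 ![s.σ X, (B Y : SmoothSec E F₀ A₀), (B Z : SmoothSec E F₀ A₀)]) = i₂
  generalize (cochainOfThree fun X Y Z => Q.l3 ![(B X : SmoothSec E F₀ A₀),
      (B Y : SmoothSec E F₀ A₀), (B Z : SmoothSec E F₀ A₀)]) = i₃
  change ∃ c₂ c₃ c₄ c₅, ∀ t : ℝ, W _ _ = W _ _ - t • (W _ _ + W _ _) + _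
  simp only [hl, hr, hl', hr']
  refine ⟨W r₁ i₁ - W r₀ i₂ - W r₂ i₀, W r₁ i₂ + W r₂ i₁ - W r₀ i₃, W r₁ i₃ + W r₂ i₂, W r₂ i₃,
    fun t => ?_⟩
  module

theorem formRγIγ_congr {s s' : Q.Splitting} (h : s.σ = s'.σ) :
    Q.formRγIγ s = Q.formRγIγ s' := by
  rw [formRγIγ, formRγIγ, Rγ_eq, Rγ_eq, Iγ_eq, Iγ_eq]
  cases s
  cases s'
  cases h
  rfl

theorem exists_formRγIγ_sub_eq_extDer (s s' : Q.Splitting) : ∃ η : DiffForm E M 4, ∀ X,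
    Q.formRγIγ s' X - Q.formRγIγ s X = extDer η X := by
  let B : SmoothVF E M →ₗ[SmoothFun E M] Q.ker :=
    (s'.σ - s.σ).codRestrict Q.ker fun X => by
      rw [LinearMap.mem_ker, LinearMap.sub_apply, map_sub, s.ρ_σ, s'.ρ_σ, sub_self]
  let η (t : ℝ) : DiffForm E M 4 := Q.transgression (s.shift (t • B)) B
  -- Simpson's weights on `[0, 1]`, in place of the integral of `-η`.
  refine ⟨-((6⁻¹ : ℝ) • (η 0 + (4 : ℝ) • η 2⁻¹ + η 1)), fun X => ?_⟩
  have h0 : Q.formRγIγ s = Q.formRγIγ (s.shift ((0 : ℝ) • B)) :=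
    Q.formRγIγ_congr (by rw [zero_smul]; exact (add_zero s.σ).symm)
  -- The shifted splitting has the `σ` of `s'` but keeps the `γ` of `s`, which does not affect the
  -- form.
  have h1 : Q.formRγIγ s' = Q.formRγIγ (s.shift ((1 : ℝ) • B)) :=
    Q.formRγIγ_congr (by rw [one_smul]; exact (add_sub_cancel s.σ s'.σ).symm)
  obtain ⟨g₀, g₁, g₂, g₃, hg⟩ := Q.extDer_transgression_shift s B X
  rw [extDer_neg, extDer_smul, extDer_add, extDer_add, extDer_smul, h0, h1]
  ext x
  have key := simpson_of_taylor (F := fun t => Q.formRγIγ (s.shift (t • B)) X x)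
    (g := fun t => extDer (η t) X x) (g₀ := g₀ x) (g₁ := g₁ x) (g₂ := g₂ x) (g₃ := g₃ x)
    -- The expansion about an arbitrary `t` is the one about `0` for the splitting already shifted
    -- by `tB`, since shifts add up.
    (fun t => congrArg (fun f : SmoothFun E M => f x) (hg t)) (fun t => by
      obtain ⟨c₂, c₃, c₄, c₅, h⟩ := Q.formRγIγ_shift (s.shift (t • B)) B X
      refine ⟨c₂ x, c₃ x, c₄ x, c₅ x, fun u => ?_⟩
      have e : (s.shift (t • B)).shift (u • B) = s.shift ((t + u) • B) :=
        (shift_shift s (t • B) (u • B)).trans (congrArg s.shift (add_smul t u B).symm)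
      have h' := h u
      rw [e] at h'
      exact congrArg (fun f : SmoothFun E M => f x) h')
  exact key

end QuadraticLieTwoAlgebroid

end Transgression

/-! ### Well-definedness of the first Pontryagin class. -/

theorem theorem4
    {E : Type*} [NormedAddCommGroup E] [NormedSpace ℝ E] [FiniteDimensional ℝ E]
    {M : Type*} [TopologicalSpace M] [ChartedSpace E M] [IsManifold 𝓘(ℝ, E) ∞ M]
    [T2Space M] [SigmaCompactSpace M]
    {F₀ : Type*} [NormedAddCommGroup F₀] [NormedSpace ℝ F₀] [FiniteDimensional ℝ F₀]
    {A₀ : M → Type*} [TopologicalSpace (TotalSpace F₀ A₀)] [∀ x, TopologicalSpace (A₀ x)]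
    [FiberBundle F₀ A₀] [∀ x, AddCommGroup (A₀ x)] [∀ x, Module ℝ (A₀ x)] [VectorBundle ℝ F₀ A₀]
    [ContMDiffVectorBundle ∞ F₀ A₀ 𝓘(ℝ, E)]
    {F₁ : Type*} [NormedAddCommGroup F₁] [NormedSpace ℝ F₁] [FiniteDimensional ℝ F₁]
    {A₁ : M → Type*} [TopologicalSpace (TotalSpace F₁ A₁)] [∀ x, TopologicalSpace (A₁ x)]
    [FiberBundle F₁ A₁] [∀ x, AddCommGroup (A₁ x)] [∀ x, Module ℝ (A₁ x)] [VectorBundle ℝ F₁ A₁]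
    [ContMDiffVectorBundle ∞ F₁ A₁ 𝓘(ℝ, E)]
    (Q : QuadraticLieTwoAlgebroid E F₀ A₀ F₁ A₁) :
    ∃ (h : ∀ s : Q.Splitting, Q.formRγIγ s ∈ closedForms E M 5)
      (h' : ∀ s : Q.Splitting, Q.formRI s ∈ closedForms E M 5),
      (∀ s s' : Q.Splitting,
        deRhamClass (Q.formRγIγ s) (h s) = deRhamClass (Q.formRγIγ s') (h s')) ∧
      ∀ s : Q.Splitting,
        deRhamClass (Q.formRI s) (h' s) = deRhamClass (Q.formRγIγ s) (h s) := by
  have h := Q.formRγIγ_mem_closedForms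
  have h' : ∀ s : Q.Splitting, Q.formRI s ∈ closedForms E M 5 := fun s => by
    obtain ⟨η, hη⟩ := Q.formRI_sub_formRγIγ s
    -- `S(R, I)` is closed because it differs from a closed form by an exact one.
    have hd : Q.formRI s - Q.formRγIγ s ∈ closedForms E M 5 := extDer_extDer hη
    have := (closedForms E M 5).add_mem hd (h s)
    rwa [sub_add_cancel] at this
  refine ⟨h, h', fun s s' => ?_, fun s => ?_⟩
  · obtain ⟨η, hη⟩ := Q.exists_formRγIγ_sub_eq_extDer s s'
    exact deRhamClass_eq_of_sub_eq_extDer _ _ hη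
  · obtain ⟨η, hη⟩ := Q.formRI_sub_formRγIγ s
    exact (deRhamClass_eq_of_sub_eq_extDer _ _ hη).symm
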